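/- Let $K$ be an algebraically closed field, let $t\ge 1$, and let $Q$ be the quiver with vertices $1,\dots,t$ and arrows $l+1\to l$ $(1\le l<t)$. For a dimension vector $d=(d_1,\dots,d_t)$ let $$\mathcal R(Q,d)=\bigoplus_{l=1}^{t-1}\operatorname{Hom}(K^{d_{l+1}},K^{d_l})$$ with the Zariski topology and with the action $(g\cdot A)_{l,l+1}=g_lA_{l,l+1}g_{l+1}^{-1}$ of $\mathrm{Gl}(d)=\prod_{l=1}^t\mathrm{Gl}(d_l)$. For $A=(A_{1,2},\dots,A_{t-1,t})\in\mathcal R(Q,d)$ and $1\le i<j\le t$ put $A_{(i,j)}=A_{i,i+1}A_{i+1,i+2}\cdots A_{j-1,j}$, $r_{i,j}=\min\{d_l\mid i\le l\le j\}$ and $$Y_{i,j}=\{A\in\mathcal R(Q,d)\mid \operatorname{rk}A_{(i,j)}\le r_{i,j}-1\}.$$ Let $J(d)$ be the set of pairs $(i,j)$ with $1\le i<j\le t$ such that $d_l>\max\{d_i,d_j\}$ for all $i<l<j$. A segment $[a,b]$ with $1\le a\le b\le t$ stands for the representation with the space $K$ at the vertices $a,\dots,b$, zero elsewhere, and identity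 maps between consecutive copies of $K$; a multisegment is a finite direct sum of segments. For a dimension vector $e$, let $M(e)$ be the multisegment whose summands are, for each $h\ge1$, the maximal segments $[a,b]$ in $[1,t]$ with $e_l\ge h$ for all $a\le l\le b$. Proposition 3.1. Let $(i,j)\in J(d)$ with $d_i>0$ and $d_j>0$. Then $Y_{i,j}$ is closed and irreducible, of codimension $|d_j-d_i|+1$ in $\mathcal R(Q,d)$. Moreover, let $[p,q]\subseteq[1,t]$ be the largest segment that contains $[i,j]$ and satisfies $d_l\ge\min\{d_i,d_j\}$ for all $p\le l\le q$. Then $Y_{i,j}$ is the closure of the $\mathrm{Gl}(d)$-orbit of a representation isomorphic to the multisegment $$[p,j-1]\oplus[i+1,q]\oplus M(e),\qquad e=d-\underline{\dim}\big([p,j-1]\oplus[i+1,q]\big).$$ If $(i,j)=(1,t)$, this multisegment is $[1,t-1]\oplus[2,t]\oplus M(e)$, where $e_l=d_l-1$ for $l\in\{1,t\}$ and $e_l=d_l-2$ for $1<l<t$. -/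

import Mathlib

namespace QuiverA

/-! Representations of the quiver `1 ← 2 ← ⋯ ← t`. Vertices are the natural numbers in `[1, t]`;
only the values `d 1, …, d t` of a dimension vector `d : ℕ → ℕ` are ever used. -/

/-- The representation space `R(Q, d)`: one matrix `A_{l,l+1} : K^{d (l+1)} → K^{d l}` for each
`1 ≤ l < t`. -/
def Rep (K : Type*) (t : ℕ) (d : ℕ → ℕ) : Type _ :=
  (l : Finset.Ico 1 t) → Matrix (Fin (d l)) (Fin (d (l + 1))) K

/-- The set indexing all matrix entries of a representation. -/
abbrev Entry (t : ℕ) (d : ℕ → ℕ) : Type :=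
  (l : Finset.Ico 1 t) × (Fin (d l) × Fin (d (l + 1)))

/-- The entries of a representation: the identification of `R(Q, d)` with an affine space. -/
def Rep.coords {K : Type*} {t : ℕ} {d : ℕ → ℕ} (A : Rep K t d) : Entry t d → K :=
  fun e => A e.1 e.2.1 e.2.2

/-- The Zariski topology on the affine space `R(Q, d)`, induced by sending a point to its maximal
ideal; the closed sets are the common zero sets of families of polynomials in the entries. -/
noncomputable instance Rep.zariski (K : Type*) [Field K] (t : ℕ) (d : ℕ → ℕ) : TopologicalSpace (Rep K t d) :=
  TopologicalSpace.induced
    (fun A => (MvPolynomial.pointToPoint A.coords : PrimeSpectrum (MvPolynomial (Entry t d) K)))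
    inferInstance

/-- The codimension of a closed subset `Z` of a topological space `X`: the infimum, over the
irreducible closed subsets `W` of `Z`, of the supremum of the lengths `n` of the chains
`W = W₀ ⊂ W₁ ⊂ ⋯ ⊂ Wₙ` of irreducible closed subsets of `X`. -/
noncomputable def codim {X : Type*} [TopologicalSpace X] (Z : Set X) : ℕ∞ :=
  ⨅ W : {W : TopologicalSpace.IrreducibleCloseds X // (W : Set X) ⊆ Z}, Order.coheight W.1

section

variable {K : Type*} [Field K] {t : ℕ} {d : ℕ → ℕ}

/-- The map `A_{l,l+1}` (zero if `l` is not the target of an arrow). -/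
def Rep.map (A : Rep K t d) (l : ℕ) : Matrix (Fin (d l)) (Fin (d (l + 1))) K :=
  if h : l ∈ Finset.Ico 1 t then A ⟨l, h⟩ else 0

/-- The composition `A_{i,i+1} A_{i+1,i+2} ⋯ A_{i+n-1,i+n}`. -/
def Rep.comp (A : Rep K t d) (i : ℕ) : (n : ℕ) → Matrix (Fin (d i)) (Fin (d (i + n))) K
  | 0 => (1 : Matrix (Fin (d i)) (Fin (d i)) K)
  | n + 1 => Rep.comp A i n * A.map (i + n)

/-- `rk A_{(i,j)}`, where `A_{(i,j)} = A_{i,i+1} ⋯ A_{j-1,j}`, for `i ≤ j`. -/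
noncomputable def Rep.rk (A : Rep K t d) (i j : ℕ) : ℕ := (A.comp i (j - i)).rank

/-- `r_{i,j} = min {d l | i ≤ l ≤ j}`, for `i ≤ j`. -/
noncomputable def maxRank (d : ℕ → ℕ) (i j : ℕ) : ℕ := sInf (d '' Set.Icc i j)

variable (K t d) in
/-- `Y_{i,j} = {A | rk A_{(i,j)} ≤ r_{i,j} - 1}`. -/
def degeneracyLocus (i j : ℕ) : Set (Rep K t d) :=
  {A | (A.rk i j : ℤ) ≤ (maxRank d i j : ℤ) - 1}

/-- The set `J(d)`. -/
def J (t : ℕ) (d : ℕ → ℕ) : Set (ℕ × ℕ) :=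
  {x | 1 ≤ x.1 ∧ x.1 < x.2 ∧ x.2 ≤ t ∧ ∀ l, x.1 < l → l < x.2 → max (d x.1) (d x.2) < d l}

lemma left_mem {l t : ℕ} (h : l ∈ Finset.Ico 1 t) : l ∈ Finset.Icc 1 t := by
  simp only [Finset.mem_Ico, Finset.mem_Icc] at *; omega

lemma right_mem {l t : ℕ} (h : l ∈ Finset.Ico 1 t) : l + 1 ∈ Finset.Icc 1 t := by
  simp only [Finset.mem_Ico, Finset.mem_Icc] at *; omega

/-- The orbit of `A` under `GL(d) = ∏_{l=1}^t GL(d l)`, which acts by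
`(g • A)_{l,l+1} = g_l A_{l,l+1} g_{l+1}⁻¹`. -/
def Rep.orbit (A : Rep K t d) : Set (Rep K t d) :=
  {B | ∃ g : (l : Finset.Icc 1 t) → GL (Fin (d l)) K, ∀ (l : ℕ) (h : l ∈ Finset.Ico 1 t),
    B ⟨l, h⟩ = (g ⟨l, left_mem h⟩).1 * A ⟨l, h⟩ * (g ⟨l + 1, right_mem h⟩)⁻¹.1}

end

/-- A multisegment; the pair `(a, b)` stands for the segment `[a, b]`. -/
abbrev Multisegment : Type := Multiset (ℕ × ℕ)

namespace Multisegment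

/-- The summands of `M` (counted with multiplicity) that contain the vertex `l`. -/
abbrev At (M : Multisegment) (l : ℕ) : Type :=
  {s : Multiset.ToType M // s.1.1 ≤ l ∧ l ≤ s.1.2}

/-- The dimension vector of a multisegment. -/
def dim (M : Multisegment) (l : ℕ) : ℕ := Multiset.countP (fun s => s.1 ≤ l ∧ l ≤ s.2) M

/-- The representation `⊕ [a, b]` given by `M` has the space `M.At l → K` at the vertex `l`, with
one basis vector for each summand that contains `l`. Its map from vertex `l + 1` to vertex `l` sends
the basis vector of a summand to the basis vector of the same summand, or to zero if that summand
does not contain `l`. -/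
def repMap (K : Type*) [Field K] (M : Multisegment) (l : ℕ) :
    (M.At (l + 1) → K) →ₗ[K] (M.At l → K) where
  toFun f s := if h : l + 1 ≤ s.1.1.2 then f ⟨s.1, s.2.1.trans (Nat.le_succ l), h⟩ else 0
  map_add' f g := by ext s; simp only [Pi.add_apply]; split_ifs <;> simp
  map_smul' c f := by ext s; simp only [Pi.smul_apply, RingHom.id_apply]; split_ifs <;> simp

end Multisegment

/-- The representation `A` is isomorphic to the one given by the multisegment `M`. -/
def Rep.IsoTo {K : Type*} [Field K] {t : ℕ} {d : ℕ → ℕ} (A : Rep K t d) (M : Multisegment) :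
    Prop :=
  ∃ φ : (l : Finset.Icc 1 t) → ((Fin (d l) → K) ≃ₗ[K] (M.At l → K)),
    ∀ (l : ℕ) (h : l ∈ Finset.Ico 1 t) (v : Fin (d (l + 1)) → K),
      φ ⟨l, left_mem h⟩ (Matrix.mulVec (A ⟨l, h⟩) v) =
        M.repMap K l (φ ⟨l + 1, right_mem h⟩ v)

/-- The generic multisegment `M(d)`: in the diagram with `d l` vertices in the column `l`, in the
rows `1, …, d l`, connect neighbouring vertices of each row; the summands of `M(d)` are the
connected components. Here `[a, b]` is a component of the row `h` if `d ≥ h` on `[a, b]` and `[a, b]`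
cannot be enlarged inside `[1, t]`. -/
def generic (t : ℕ) (d : ℕ → ℕ) : Multisegment :=
  ∑ h ∈ Finset.Icc 1 ((Finset.Icc 1 t).sup d),
    ((Finset.Icc 1 t ×ˢ Finset.Icc 1 t).filter fun s : ℕ × ℕ =>
      s.1 ≤ s.2 ∧ (∀ l ∈ Finset.Icc s.1 s.2, h ≤ d l) ∧
        (s.1 = 1 ∨ d (s.1 - 1) < h) ∧ (s.2 = t ∨ d (s.2 + 1) < h)).val

/-- The left end of the largest subinterval of `[1, t]` that contains `[i, j]` and on which
`d ≥ min (d i) (d j)` (for `(i, j) ∈ J(d)`). -/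
noncomputable def leftEnd (d : ℕ → ℕ) (i j : ℕ) : ℕ :=
  sInf {p | 1 ≤ p ∧ p ≤ i ∧ ∀ l, p ≤ l → l ≤ i → min (d i) (d j) ≤ d l}

/-- The right end of the largest subinterval of `[1, t]` that contains `[i, j]` and on which
`d ≥ min (d i) (d j)` (for `(i, j) ∈ J(d)`). -/
noncomputable def rightEnd (t : ℕ) (d : ℕ → ℕ) (i j : ℕ) : ℕ :=
  sSup {q | j ≤ q ∧ q ≤ t ∧ ∀ l, j ≤ l → l ≤ q → min (d i) (d j) ≤ d l}

/-- With `p = leftEnd d i j` and `q = rightEnd t d i j`, the multisegment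
`[p, j-1] ⊕ [i+1, q]`. -/
noncomputable def brokenPair (t : ℕ) (d : ℕ → ℕ) (i j : ℕ) : Multisegment :=
  {(leftEnd d i j, j - 1), (i + 1, rightEnd t d i j)}

/-- The multisegment `M(i,j) = [p, j-1] ⊕ [i+1, q] ⊕ M(e)` of dimension vector `d`, where
`e = d - dim ([p, j-1] ⊕ [i+1, q])`. -/
noncomputable def almostGeneric (t : ℕ) (d : ℕ → ℕ) (i j : ℕ) : Multisegment :=
  brokenPair t d i j + generic t (fun l => d l - (brokenPair t d i j).dim l)

end QuiverA

/-!
The proof classifies representations up to isomorphism, degenerates them explicitly, and measures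
the codimension by comparing determinantal equations with chains of irreducible closed sets.

*Decomposition.* Every representation is a direct sum of segments (`exists_isFrame`): one splits off
a nonzero path of maximal length. Its multisegment determines the orbit
(`HasSummands.mem_orbit`), and `rk A_(i,j)` is the number of summands that contain `[i, j]`
(`IsFrame.rank_comp`).

*Degeneration.* If two summands are linked, that is, if their union is a segment larger than both,
then along an explicit line through `A` all other points have these two summands exchanged for
their union and intersection (`IsFrame.exists_deformation`). Hence `A` lies in the closure of any
set containing all representations of the exchanged type. Starting from a point of `Y_{i,j}`, one
exchanges linked summands as long as the rank condition remains valid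
(`mem_closure_almostGeneric`). When no exchange is possible any more, counting the segments through
each vertex, which is where `d l > max (d i) (d j)` for `i < l < j` enters, shows that the
multisegment consists of `[p, j-1]`, `[i+1, q]` and a part without linked pairs
(`exists_isBroken`). A multisegment without linked pairs is determined by its dimension vector
(`Multisegment.Unlinked.eq_of_dim_eq`), so that this part is `M(e)`. Therefore `Y_{i,j}` is the
closure of one orbit, and it is irreducible because any two points of an orbit are joined by a
rational curve in it (`isIrreducible_orbit`).

*Codimension.* Near a matrix of rank `r - 1` with `r` rows and `n ≥ r` columns, the condition that
the rank is smaller than `r` is given by `n - r + 1` minors. With the Nullstellensatz and Krull's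
height theorem this bounds the codimension from above (`coheight_le_of_rank_lt`). For the lower
bound, one lowers the larger one of `d i`, `d j` by one: the inverse image of the smaller locus
under the restriction of matrices is irreducible, closed and strictly larger than `Y_{i,j}`
(`coheight_irreducibleLocus_add_one_le`), and induction on `|d j - d i|` gives a chain of the
required length.
-/

namespace QuiverA

/-! ### Regular functions and the Zariski topology -/

section Regular

variable {K : Type*} [Field K] {t : ℕ} {d : ℕ → ℕ}

variable (K t d) in
/-- The algebra of regular functions on the affine space `R(Q, d)`. -/
noncomputable def regular : Subalgebra K (Rep K t d → K) :=
  (MvPolynomial.aeval (R := K) fun (e : Entry t d) (A : Rep K t d) => A.coords e).range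

lemma aeval_coords_apply (f : MvPolynomial (Entry t d) K) (A : Rep K t d) :
    MvPolynomial.aeval (R := K) (fun (e : Entry t d) (A : Rep K t d) => A.coords e) f A =
      MvPolynomial.eval A.coords f := by
  induction f using MvPolynomial.induction_on with
  | C a => simp
  | add p q hp hq => simp [hp, hq]
  | mul_X p e hp => simp [hp]

lemma mem_regular {h : Rep K t d → K} :
    h ∈ regular K t d ↔ ∃ f : MvPolynomial (Entry t d) K,
      ∀ A, MvPolynomial.eval A.coords f = h A := by
  simp only [regular, AlgHom.mem_range]
  exact exists_congr fun f => by simp only [funext_iff, aeval_coords_apply]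

lemma regular_entry (l : Finset.Ico 1 t) (a : Fin (d l)) (b : Fin (d (l + 1))) :
    (fun A : Rep K t d => A l a b) ∈ regular K t d :=
  mem_regular.2 ⟨.X ⟨l, a, b⟩, fun A => by simp [Rep.coords]⟩

lemma regular_const (c : K) : (fun _ : Rep K t d => c) ∈ regular K t d :=
  (regular K t d).algebraMap_mem c

lemma regular_sum {ι : Type*} (s : Finset ι) {f : ι → Rep K t d → K}
    (hf : ∀ i ∈ s, f i ∈ regular K t d) : (fun A => ∑ i ∈ s, f i A) ∈ regular K t d := by
  simpa [← Finset.sum_fn] using (regular K t d).sum_mem hf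

lemma regular_prod {ι : Type*} (s : Finset ι) {f : ι → Rep K t d → K}
    (hf : ∀ i ∈ s, f i ∈ regular K t d) : (fun A => ∏ i ∈ s, f i A) ∈ regular K t d := by
  simpa [← Finset.prod_fn] using (regular K t d).prod_mem hf

/-- A matrix-valued function on `R(Q, d)` all of whose entries are regular. -/
def RegularMatrix {m n : Type*} (F : Rep K t d → Matrix m n K) : Prop :=
  ∀ a b, (fun A => F A a b) ∈ regular K t d

lemma RegularMatrix.const {m n : Type*} (C : Matrix m n K) :
    RegularMatrix fun _ : Rep K t d => C :=
  fun _ _ => regular_const _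

lemma RegularMatrix.mul {m n p : Type*} [Fintype n] {F : Rep K t d → Matrix m n K}
    {G : Rep K t d → Matrix n p K} (hF : RegularMatrix F) (hG : RegularMatrix G) :
    RegularMatrix fun A => F A * G A :=
  fun a b => regular_sum _ fun c _ => (regular K t d).mul_mem (hF a c) (hG c b)

lemma RegularMatrix.det {n : Type*} [Fintype n] [DecidableEq n] {F : Rep K t d → Matrix n n K}
    (hF : RegularMatrix F) : (fun A => (F A).det) ∈ regular K t d := by
  simp only [Matrix.det_apply]
  exact regular_sum _ fun σ _ => (regular K t d).zsmul_mem
    (regular_prod Finset.univ fun i _ => hF (σ i) i) (Equiv.Perm.sign σ : ℤ)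

lemma RegularMatrix.map (l : ℕ) : RegularMatrix fun A : Rep K t d => A.map l := by
  intro a b
  by_cases h : l ∈ Finset.Ico 1 t
  · simpa [Rep.map, h] using regular_entry ⟨l, h⟩ a b
  · simpa [Rep.map, h] using regular_const (0 : K)

lemma RegularMatrix.comp (i n : ℕ) : RegularMatrix fun A : Rep K t d => A.comp i n := by
  induction n with
  | zero => exact .const (1 : Matrix (Fin (d i)) (Fin (d i)) K)
  | succ n ih => exact ih.mul (.map (i + n))

/-- The Zariski closed sets are the common zero sets of families of polynomials. -/
lemma isClosed_iff_zeros {Z : Set (Rep K t d)} :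
    IsClosed Z ↔ ∃ S : Set (MvPolynomial (Entry t d) K),
      Z = {A | ∀ f ∈ S, MvPolynomial.eval A.coords f = 0} := by
  rw [isClosed_induced_iff]
  simp only [PrimeSpectrum.isClosed_iff_zeroLocus]
  have key (S : Set (MvPolynomial (Entry t d) K)) :
      (fun A : Rep K t d => (MvPolynomial.pointToPoint A.coords :
        PrimeSpectrum (MvPolynomial (Entry t d) K))) ⁻¹' PrimeSpectrum.zeroLocus S =
      {A | ∀ f ∈ S, MvPolynomial.eval A.coords f = 0} := by
    ext A
    simp only [Set.mem_preimage, PrimeSpectrum.mem_zeroLocus, Set.mem_ofPred_eq,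
      MvPolynomial.pointToPoint, Set.subset_def, SetLike.mem_coe,
      MvPolynomial.mem_vanishingIdeal_singleton_iff]
    rfl
  constructor
  · rintro ⟨_, ⟨S, rfl⟩, rfl⟩
    exact ⟨S, key S⟩
  · rintro ⟨S, rfl⟩
    exact ⟨_, ⟨S, rfl⟩, key S⟩

lemma isClosed_zero {h : Rep K t d → K} (hh : h ∈ regular K t d) : IsClosed {A | h A = 0} := by
  obtain ⟨f, hf⟩ := mem_regular.1 hh
  exact isClosed_iff_zeros.2 ⟨{f}, by simp [hf]⟩

/-- A point outside a closed set is separated from it by a regular function. -/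
lemma exists_regular_of_isOpen {U : Set (Rep K t d)} (hU : IsOpen U) {A : Rep K t d}
    (hA : A ∈ U) : ∃ h ∈ regular K t d, h A ≠ 0 ∧ ∀ B, h B ≠ 0 → B ∈ U := by
  obtain ⟨S, hS⟩ := isClosed_iff_zeros.1 hU.isClosed_compl
  have hA' : A ∉ Uᶜ := by simpa using hA
  rw [hS] at hA'
  simp only [Set.mem_ofPred_eq, not_forall] at hA'
  obtain ⟨f, hf, hne⟩ := hA'
  refine ⟨_, mem_regular.2 ⟨f, fun _ => rfl⟩, hne, fun B hB => ?_⟩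
  by_contra hBU
  have : B ∈ Uᶜ := hBU
  rw [hS] at this
  exact hB (this f hf)

/-- A map between representation spaces with regular entries is continuous. -/
lemma continuous_of_regular {d' : ℕ → ℕ} {Φ : Rep K t d → Rep K t d'}
    (hΦ : ∀ l, RegularMatrix fun A => Φ A l) : Continuous Φ := by
  rw [continuous_iff_isClosed]
  intro Z hZ
  obtain ⟨S, rfl⟩ := isClosed_iff_zeros.1 hZ
  have hreg (f : MvPolynomial (Entry t d') K) :
      (fun A => MvPolynomial.eval (Φ A).coords f) ∈ regular K t d := by
    induction f using MvPolynomial.induction_on with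
    | C a => simpa using regular_const a
    | add p q hp hq => simp only [map_add]; exact (regular K t d).add_mem hp hq
    | mul_X p e hp =>
      simp only [map_mul, MvPolynomial.eval_X]
      exact (regular K t d).mul_mem hp (hΦ e.1 e.2.1 e.2.2)
  have : Φ ⁻¹' {A | ∀ f ∈ S, MvPolynomial.eval A.coords f = 0} =
      ⋂ f ∈ S, {A | MvPolynomial.eval (Φ A).coords f = 0} := by
    ext A; simp
  rw [this]
  exact isClosed_biInter fun f _ => isClosed_zero (hreg f)

end Regular

section Rank

/-- A matrix has rank at least `r` as soon as some `r × r` matrix factoring through it is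
invertible, and conversely. -/
lemma le_rank_iff_exists_det {K : Type*} [Field K] {m n : ℕ} (M : Matrix (Fin m) (Fin n) K)
    (r : ℕ) :
    r ≤ M.rank ↔ ∃ (P : Matrix (Fin r) (Fin m) K) (Q : Matrix (Fin n) (Fin r) K),
      (P * M * Q).det ≠ 0 := by
  constructor
  · intro h
    obtain ⟨f, hf⟩ := (finrank_le_iff_exists_linearMap (R := K) (M := Fin r → K)
      (M' := LinearMap.range M.mulVecLin)).1 (by simpa [Matrix.rank] using h)
    have hs : ∀ k : Fin r, ∃ x, M.mulVecLin x = f (Pi.single k 1) := fun k => (f _).2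
    choose x hx using hs
    let Q : Matrix (Fin n) (Fin r) K := Matrix.of fun a k => x k a
    have hMQ : ∀ y, (M * Q).mulVecLin y = f y := by
      have : (M * Q).mulVecLin = (LinearMap.range M.mulVecLin).subtype ∘ₗ f := by
        refine LinearMap.pi_ext' fun k => LinearMap.ext_ring ?_
        have : Q.mulVec (Pi.single k 1) = x k := by ext a; simp [Q]
        simp [this, ← hx]
      intro y; rw [this]; rfl
    have hinj : Function.Injective (M * Q).mulVecLin := by
      intro y z hyz
      exact hf (Subtype.ext (by rw [← hMQ, ← hMQ, hyz]))
    obtain ⟨g, hg⟩ := (M * Q).mulVecLin.exists_leftInverse_of_injective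
      (LinearMap.ker_eq_bot.2 hinj)
    refine ⟨LinearMap.toMatrix' g, Q, ?_⟩
    have : LinearMap.toMatrix' g * M * Q = 1 := by
      rw [Matrix.mul_assoc, ← LinearMap.toMatrix'_toLin' (M * Q), Matrix.toLin'_apply',
        ← LinearMap.toMatrix'_comp, hg, LinearMap.toMatrix'_id]
    simp [this]
  · rintro ⟨P, Q, h⟩
    have h1 : (P * M * Q).rank = r := by
      rw [Matrix.rank_of_isUnit _ ((Matrix.isUnit_iff_isUnit_det _).2 (Ne.isUnit h))]; simp
    calc r = (P * M * Q).rank := h1.symm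
      _ ≤ (P * M).rank := Matrix.rank_mul_le_left _ _
      _ ≤ M.rank := Matrix.rank_mul_le_right _ _

variable {K : Type*} [Field K] {t : ℕ} {d : ℕ → ℕ}

lemma isClosed_rank_lt {m n : ℕ} {F : Rep K t d → Matrix (Fin m) (Fin n) K}
    (hF : RegularMatrix F) (r : ℕ) : IsClosed {A | (F A).rank < r} := by
  have : {A | (F A).rank < r} = ⋂ (P : Matrix (Fin r) (Fin m) K) (Q : Matrix (Fin n) (Fin r) K),
      {A | (P * F A * Q).det = 0} := by
    ext A
    have := le_rank_iff_exists_det (F A) r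
    simp only [Set.mem_ofPred_eq, Set.mem_iInter]
    rw [← not_le, this]; push Not; rfl
  rw [this]
  exact isClosed_iInter fun P => isClosed_iInter fun Q =>
    isClosed_zero (((RegularMatrix.const P).mul hF).mul (.const Q)).det

end Rank

/-! ### Rational curves and irreducible sets -/

section Curves

variable {K : Type*} [Field K] {t : ℕ} {d : ℕ → ℕ}

/-- `γ : K → R(Q, d)` is a rational curve with denominator `q`: away from the zeros of `q`, its
entries are quotients of polynomials by `q`. -/
def IsRationalCurve (q : Polynomial K) (γ : K → Rep K t d) : Prop :=
  ∀ l a b, ∃ p : Polynomial K, ∀ s, q.eval s ≠ 0 → q.eval s * γ s l a b = p.eval s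

/-- Up to a power of the denominator, a regular function is polynomial along a rational curve. -/
lemma IsRationalCurve.exists_polynomial {q : Polynomial K} {γ : K → Rep K t d}
    (hγ : IsRationalCurve q γ) {h : Rep K t d → K} (hh : h ∈ regular K t d) :
    ∃ (N : ℕ) (p : Polynomial K), ∀ s, q.eval s ≠ 0 →
      q.eval s ^ N * h (γ s) = p.eval s := by
  obtain ⟨f, hf⟩ := mem_regular.1 hh
  simp only [← hf]
  clear hf hh
  induction f using MvPolynomial.induction_on with
  | C a => exact ⟨0, .C a, by simp⟩
  | add f g hf hg =>
    obtain ⟨N, p, hp⟩ := hf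
    obtain ⟨N', p', hp'⟩ := hg
    refine ⟨N + N', q ^ N' * p + q ^ N * p', fun s hs => ?_⟩
    simp only [map_add, Polynomial.eval_add, Polynomial.eval_mul, Polynomial.eval_pow, ← hp s hs,
      ← hp' s hs]
    ring
  | mul_X f e hf =>
    obtain ⟨N, p, hp⟩ := hf
    obtain ⟨p', hp'⟩ := hγ e.1 e.2.1 e.2.2
    refine ⟨N + 1, p * p', fun s hs => ?_⟩
    simp only [map_mul, MvPolynomial.eval_X, Polynomial.eval_mul, ← hp s hs, ← hp' s hs, Rep.coords]
    ring

lemma IsRationalCurve.exists_ne_zero {q : Polynomial K} {γ : K → Rep K t d}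
    (hγ : IsRationalCurve q γ) {h : Rep K t d → K} (hh : h ∈ regular K t d) {s₀ : K}
    (hq : q.eval s₀ ≠ 0) (hne : h (γ s₀) ≠ 0) :
    ∃ p : Polynomial K, p ≠ 0 ∧ ∀ s, q.eval s ≠ 0 → p.eval s ≠ 0 → h (γ s) ≠ 0 := by
  obtain ⟨N, p, hp⟩ := hγ.exists_polynomial hh
  refine ⟨p, ?_, fun s hqs hs h0 => hs ?_⟩
  · rintro rfl
    have := hp s₀ hq
    simp [hne, hq] at this
  · rw [← hp s hqs, h0, mul_zero]

variable [Infinite K]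

lemma exists_eval_ne_zero {p : Polynomial K} (hp : p ≠ 0) : ∃ s, p.eval s ≠ 0 := by
  by_contra! h
  exact hp (Polynomial.funext (by simpa using h))

/-- A limit along a line: if all points `s ≠ 0` of a polynomial curve lie in `S`, then its point
`s = 0` lies in the Zariski closure of `S`. -/
lemma IsRationalCurve.zero_mem_closure {γ : K → Rep K t d} (hγ : IsRationalCurve 1 γ)
    {S : Set (Rep K t d)} (hS : ∀ s, s ≠ 0 → γ s ∈ S) : γ 0 ∈ closure S := by
  rw [mem_closure_iff]
  intro U hU h0
  obtain ⟨h, hh, hne, hU⟩ := exists_regular_of_isOpen hU h0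
  obtain ⟨p, hp, hps⟩ := hγ.exists_ne_zero hh (by simp) hne
  obtain ⟨s, hs⟩ := exists_eval_ne_zero (mul_ne_zero hp Polynomial.X_ne_zero)
  simp only [Polynomial.eval_mul, Polynomial.eval_X, mul_ne_zero_iff] at hs
  exact ⟨γ s, hU _ (hps s (by simp) hs.1), hS s hs.2⟩

/-- A set in which any two points are joined by a rational curve is irreducible. -/
lemma isPreirreducible_of_rationalCurves {S : Set (Rep K t d)}
    (hS : ∀ A ∈ S, ∀ B ∈ S, ∃ (q : Polynomial K) (γ : K → Rep K t d), IsRationalCurve q γ ∧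
      γ 0 = A ∧ γ 1 = B ∧ q.eval 0 ≠ 0 ∧ q.eval 1 ≠ 0 ∧ ∀ s, q.eval s ≠ 0 → γ s ∈ S) :
    IsPreirreducible S := by
  rintro U V hU hV ⟨A, hA, hAU⟩ ⟨B, hB, hBV⟩
  obtain ⟨q, γ, hγ, rfl, rfl, hq0, hq1, hmem⟩ := hS A hA B hB
  obtain ⟨h, hh, hne, hU'⟩ := exists_regular_of_isOpen hU hAU
  obtain ⟨h', hh', hne', hV'⟩ := exists_regular_of_isOpen hV hBV
  obtain ⟨p, hp, hps⟩ := hγ.exists_ne_zero hh hq0 hne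
  obtain ⟨p', hp', hps'⟩ := hγ.exists_ne_zero hh' hq1 hne'
  have hq : q ≠ 0 := by rintro rfl; simp at hq0
  obtain ⟨s, hs⟩ := exists_eval_ne_zero (mul_ne_zero (mul_ne_zero hp hp') hq)
  simp only [Polynomial.eval_mul, mul_ne_zero_iff] at hs
  exact ⟨γ s, hmem s hs.2, hU' _ (hps s hs.2 hs.1.1),
    hV' _ (hps' s hs.2 hs.1.2)⟩

variable (K t d) in
/-- The affine space `R(Q, d)` is irreducible. -/
lemma isIrreducible_univ_rep : IsIrreducible (Set.univ : Set (Rep K t d)) := by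
  refine ⟨⟨fun _ => 0, trivial⟩, isPreirreducible_of_rationalCurves fun A _ B _ => ?_⟩
  refine ⟨1, fun s l => A l + s • (B l - A l), fun l a b => ?_,
    funext fun l => by simp, funext fun l => by simp, by simp, by simp,
    fun _ _ => trivial⟩
  exact ⟨.C (A l a b) + .X * .C (B l a b - A l a b), fun s _ => by simp⟩

end Curves

/-- The image of a product of irreducible sets under a separately continuous map is irreducible. -/
lemma isIrreducible_image2_of_separatelyContinuous {X Y Z : Type*} [TopologicalSpace X]
    [TopologicalSpace Y] [TopologicalSpace Z] {f : X → Y → Z} {S : Set X} {T : Set Y}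
    (hS : IsIrreducible S) (hT : IsIrreducible T) (hf₁ : ∀ y, Continuous fun x => f x y)
    (hf₂ : ∀ x, Continuous (f x)) : IsIrreducible (Set.image2 f S T) := by
  refine ⟨hS.1.image2 hT.1, ?_⟩
  rintro U V hU hV ⟨_, ⟨a, ha, b, hb, rfl⟩, hab⟩ ⟨_, ⟨a', ha', b', hb', rfl⟩, hab'⟩
  obtain ⟨x, hx, hxU, hxV⟩ := hS.2 _ _ (hU.preimage (hf₁ b)) (hV.preimage (hf₁ b'))
    ⟨a, ha, hab⟩ ⟨a', ha', hab'⟩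
  obtain ⟨y, hy, hyU, hyV⟩ := hT.2 _ _ (hU.preimage (hf₂ x)) (hV.preimage (hf₂ x))
    ⟨b, hb, hxU⟩ ⟨b', hb', hxV⟩
  exact ⟨_, ⟨x, hx, y, hy, rfl⟩, hyU, hyV⟩

/-! ### Decomposition into segments -/

section Frame

variable {K : Type*} [Field K] {t : ℕ} {d : ℕ → ℕ}

/-- The endomorphism of the product of all vertex spaces given by all arrows of `A` at once. -/
def Rep.shift (A : Rep K t d) : Module.End K (∀ l, Fin (d l) → K) where
  toFun w l := (A.map l).mulVec (w (l + 1))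
  map_add' v w := by ext l : 1; simp [Matrix.mulVec_add]
  map_smul' c w := by ext l : 1; simp [Matrix.mulVec_smul]

lemma Rep.shift_apply (A : Rep K t d) (w : ∀ l, Fin (d l) → K) (l : ℕ) :
    A.shift w l = (A.map l).mulVec (w (l + 1)) := rfl

lemma Rep.shift_pow_apply (A : Rep K t d) (n : ℕ) (w : ∀ l, Fin (d l) → K) (i : ℕ) :
    (A.shift ^ n) w i = (A.comp i n).mulVec (w (i + n)) := by
  induction n generalizing w with
  | zero => simp [Rep.comp]
  | succ n ih =>
    rw [pow_succ, Module.End.mul_apply, ih, shift_apply, Rep.comp, Matrix.mulVec_mulVec]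
    rfl

lemma Rep.shift_pow_congr (A : Rep K t d) {n i l : ℕ} (h : i + n = l) {v w : ∀ l, Fin (d l) → K}
    (hvw : v l = w l) : (A.shift ^ n) v i = (A.shift ^ n) w i := by
  subst h
  rw [shift_pow_apply, shift_pow_apply, hvw]

/-- A decomposition into segments of the subrepresentation `U` of `A`. The summands are indexed by
`ι`; the summand `k` is the segment `seg k`, which has no vertices if `(seg k).2 < (seg k).1`, and
`v k l` is its basis vector at the vertex `l`, or zero if `l` does not belong to it. That
the nonzero `v k l` are linearly independent is expressed by counting them. -/
structure IsFrame (A : Rep K t d) (U : ∀ l, Submodule K (Fin (d l) → K)) {ι : Type} [Fintype ι]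
    (seg : ι → ℕ × ℕ) (v : ι → ∀ l, Fin (d l) → K) : Prop where
  eq_zero : ∀ k l, ¬ ((seg k).1 ≤ l ∧ l ≤ (seg k).2) → v k l = 0
  shift : ∀ k l, A.shift (v k) l = if l + 1 ≤ (seg k).2 then v k l else 0
  span : ∀ l, Submodule.span K (Set.range fun k => v k l) = U l
  card : ∀ l, (Finset.univ.filter fun k => (seg k).1 ≤ l ∧ l ≤ (seg k).2).card =
    Module.finrank K (U l)

/-- One splits off a segment spanned by a nonzero path `v_b ↦ ⋯ ↦ v_a` of maximal length. Its
complement is cut out by a functional `ξ` on the space at `a` with `ξ v_a ≠ 0`, pulled back along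
the paths from `l` to `a`; the maximality of the length makes both parts subrepresentations. -/
theorem exists_isFrame_of_invariant (A : Rep K t d) (U : ∀ l, Submodule K (Fin (d l) → K))
    (hU : ∀ l, ∀ y ∈ U (l + 1), (A.map l).mulVec y ∈ U l)
    (hU0 : ∀ l, l ∉ Finset.Icc 1 t → U l = ⊥) :
    ∃ (ι : Type) (_ : Fintype ι) (seg : ι → ℕ × ℕ) (v : ι → ∀ l, Fin (d l) → K),
      IsFrame A U seg v := by
  classical
  induction hN : ∑ l ∈ Finset.Icc 1 t, Module.finrank K (U l) using Nat.strong_induction_on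
    generalizing U with | _ N ih
  by_cases hbot : ∀ l, U l = ⊥
  · exact ⟨Empty, inferInstance, Empty.elim, fun k => k.elim,
      ⟨fun k => k.elim, fun k => k.elim, fun l => by simp [hbot l], fun l => by rw [hbot l]; simp⟩⟩
  -- a nonzero path of maximal length `n` in `U`
  let P : ℕ → Prop := fun n => ∃ w : ∀ l, Fin (d l) → K, (∀ l, w l ∈ U l) ∧ (A.shift ^ n) w ≠ 0
  have hP0 : P 0 := by
    push Not at hbot
    obtain ⟨l, hl⟩ := hbot
    obtain ⟨y, hy, hy0⟩ := Submodule.exists_mem_ne_zero_of_ne_bot hl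
    refine ⟨Pi.single l y, fun l' => ?_, ?_⟩
    · by_cases h : l' = l
      · subst h; simpa using hy
      · simp [h]
    · simpa using hy0
  have hPt : ∀ n, P n → n ≤ t := by
    rintro n ⟨w, hw, hne⟩
    obtain ⟨a, ha⟩ := Function.ne_iff.1 hne
    by_contra hn
    have : w (a + n) = 0 := by
      have := hw (a + n)
      rwa [hU0 _ (by simp; omega), Submodule.mem_bot] at this
    exact ha (by rw [Rep.shift_pow_apply, this]; simp)
  let n := Nat.findGreatest P t
  have hPn : P n := Nat.findGreatest_spec (Nat.zero_le _) hP0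
  have hmax : ∀ w : ∀ l, Fin (d l) → K, (∀ l, w l ∈ U l) → (A.shift ^ (n + 1)) w = 0 := by
    intro w hw
    by_contra hne
    have h1 : P (n + 1) := ⟨w, hw, hne⟩
    have := Nat.le_findGreatest (hPt _ h1) h1
    simp only [n] at this; omega
  clear_value n
  obtain ⟨w, hwU, hw⟩ := hPn
  obtain ⟨a, ha⟩ := Function.ne_iff.1 hw
  obtain ⟨ξ, hξ⟩ : ∃ ξ : Module.Dual K (Fin (d a) → K), ξ ((A.shift ^ n) w a) = 1 := by
    obtain ⟨ξ, hξ⟩ : ∃ ξ : Module.Dual K (Fin (d a) → K), ξ ((A.shift ^ n) w a) ≠ 0 := by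
      by_contra! h
      exact ha ((Module.forall_dual_apply_eq_zero_iff K _).1 h)
    exact ⟨(ξ ((A.shift ^ n) w a))⁻¹ • ξ, by simp [hξ]⟩
  have hpowU : ∀ m l, (A.shift ^ m) w l ∈ U l := by
    intro m
    induction m with
    | zero => simpa using hwU
    | succ m ihm => intro l; rw [pow_succ', Module.End.mul_apply]; exact hU l _ (ihm (l + 1))
  -- the vectors of the segment, and the functionals that cut out its complement
  let x : ∀ l, Fin (d l) → K := fun l =>
    if a ≤ l ∧ l ≤ a + n then (A.shift ^ (a + n - l)) w l else 0
  let η : ∀ l, Module.Dual K (Fin (d l) → K) := fun l =>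
    if a ≤ l ∧ l ≤ a + n then
      ξ ∘ₗ LinearMap.proj a ∘ₗ (A.shift ^ (l - a)) ∘ₗ LinearMap.single K (fun l => Fin (d l) → K) l
    else 0
  have hxU : ∀ l, x l ∈ U l := by
    intro l; simp only [x]; split_ifs
    · exact hpowU _ _
    · exact zero_mem _
  have hηx : ∀ l, a ≤ l ∧ l ≤ a + n → η l (x l) = 1 := by
    intro l hl
    simp only [η, x, if_pos hl, LinearMap.comp_apply, LinearMap.proj_apply, LinearMap.coe_single]
    rw [← hξ, A.shift_pow_congr (n := l - a) (i := a) (w := (A.shift ^ (a + n - l)) w) (l := l)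
      (by omega) (by simp), ← Module.End.mul_apply, ← pow_add,
      show l - a + (a + n - l) = n by omega]
  have hη0 : ∀ l, ¬ (a ≤ l ∧ l ≤ a + n) → η l = 0 := fun l hl => by simp only [η, if_neg hl]
  have hx0 : ∀ l, ¬ (a ≤ l ∧ l ≤ a + n) → x l = 0 := fun l hl => by simp only [x, if_neg hl]
  have hxs : ∀ l, A.shift x l = if l + 1 ≤ a + n then x l else 0 := by
    intro l
    by_cases h1 : l + 1 ≤ a + n
    · rw [if_pos h1, Rep.shift_apply]
      by_cases h2 : a ≤ l + 1
      · have h3 : x (l + 1) = (A.shift ^ (a + n - (l + 1))) w (l + 1) := by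
          simp only [x, if_pos (And.intro h2 h1)]
        rw [h3, ← Rep.shift_apply, ← Module.End.mul_apply, ← pow_succ',
          show a + n - (l + 1) + 1 = a + n - l by omega]
        by_cases h4 : a ≤ l
        · simp only [x, if_pos (And.intro h4 (show l ≤ a + n by omega))]
        · rw [hx0 l (by omega), show a + n - l = n + 1 by omega, hmax w hwU]; rfl
      · rw [hx0 _ (by omega), hx0 _ (by omega)]; simp
    · rw [if_neg h1, Rep.shift_apply, hx0 _ (by omega)]; simp
  let C : ∀ l, Submodule K (Fin (d l) → K) := fun l => U l ⊓ LinearMap.ker (η l)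
  have hCinv : ∀ l, ∀ y ∈ C (l + 1), (A.map l).mulVec y ∈ C l := by
    rintro l y ⟨hy, hyη⟩
    refine ⟨hU l y hy, ?_⟩
    by_cases hl : a ≤ l ∧ l ≤ a + n
    · have h1 : η l ((A.map l).mulVec y) =
          ξ ((A.shift ^ (l - a + 1)) (Pi.single (l + 1) y) a) := by
        simp only [η, if_pos hl, LinearMap.comp_apply, LinearMap.proj_apply, LinearMap.coe_single]
        rw [pow_succ, Module.End.mul_apply]
        congr 1
        exact A.shift_pow_congr (l := l) (by omega) (by simp [Rep.shift_apply])
      change η l _ = 0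
      rw [h1]
      by_cases hl' : l + 1 ≤ a + n
      · have : η (l + 1) y = 0 := hyη
        simp only [η, if_pos (And.intro (show a ≤ l + 1 by omega) hl'), LinearMap.comp_apply,
          LinearMap.proj_apply, LinearMap.coe_single] at this
        rwa [show l - a + 1 = l + 1 - a by omega]
      · rw [show l - a + 1 = n + 1 by omega, hmax]
        · simp
        · intro l'
          by_cases h : l' = l + 1
          · subst h; simpa using hy
          · simp [h]
    · simp [hη0 l hl]
  have hsum : ∀ l, Submodule.span K {x l} ⊔ C l = U l := by
    intro l
    refine le_antisymm (sup_le ?_ inf_le_left) fun u hu => ?_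
    · simpa using hxU l
    · rw [Submodule.mem_sup]
      refine ⟨η l u • x l, Submodule.smul_mem _ _ (Submodule.mem_span_singleton_self _),
        u - η l u • x l, ⟨sub_mem hu (Submodule.smul_mem _ _ (hxU l)), ?_⟩, by simp⟩
      by_cases hl : a ≤ l ∧ l ≤ a + n
      · simp [hηx l hl]
      · simp [hη0 l hl]
  have hrank : ∀ l, Module.finrank K (U l) =
      (if a ≤ l ∧ l ≤ a + n then 1 else 0) + Module.finrank K (C l) := by
    intro l
    split_ifs with hl
    · have hne : x l ≠ 0 := fun h => by simpa [h] using hηx l hl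
      have hdisj : Submodule.span K {x l} ⊓ C l = ⊥ := by
        rw [eq_bot_iff]
        rintro y ⟨hy, -, hyη⟩
        obtain ⟨c, rfl⟩ := Submodule.mem_span_singleton.1 hy
        have : c = 0 := by simpa [hηx l hl] using hyη
        simp [this]
      have := Submodule.finrank_sup_add_finrank_inf_eq (Submodule.span K {x l}) (C l)
      rwa [hsum, hdisj, finrank_bot, add_zero, finrank_span_singleton hne] at this
    · have : C l = U l := by simp [C, hη0 l hl]
      rw [this, zero_add]
  have hamem : a ∈ Finset.Icc 1 t := by
    by_contra h
    have := hpowU n a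
    rw [hU0 a h, Submodule.mem_bot] at this
    exact ha this
  obtain ⟨ι, _, seg, v, hv⟩ := ih (∑ l ∈ Finset.Icc 1 t, Module.finrank K (C l))
    (by
      rw [← hN]
      refine Finset.sum_lt_sum (fun l _ => by rw [hrank l]; omega) ⟨a, hamem, ?_⟩
      rw [hrank a, if_pos (by omega)]; omega) C hCinv
    (fun l hl => by simp [C, hU0 l hl]) rfl
  refine ⟨Option ι, inferInstance, fun k => k.elim (a, a + n) seg, fun k => k.elim x v, ?_, ?_, ?_,
    ?_⟩
  · rintro (_ | k) l hl
    · exact hx0 l hl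
    · exact hv.eq_zero k l hl
  · rintro (_ | k) l
    · exact hxs l
    · exact hv.shift k l
  · intro l
    have : (Set.range fun k : Option ι => (k.elim x v : ∀ l, Fin (d l) → K) l) =
        insert (x l) (Set.range fun k => v k l) := by
      ext y; simp [Option.exists, eq_comm]
    rw [this, Submodule.span_insert, hv.span, hsum]
  · intro l
    rw [hrank, ← hv.card, Finset.card_filter, Finset.card_filter, Fintype.sum_option]
    rfl

variable (K t d) in
/-- The whole representation: all of the space at each vertex in `[1, t]`. -/
def whole (l : ℕ) : Submodule K (Fin (d l) → K) := if l ∈ Finset.Icc 1 t then ⊤ else ⊥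

lemma finrank_whole (l : ℕ) :
    Module.finrank K (whole K t d l) = if l ∈ Finset.Icc 1 t then d l else 0 := by
  unfold whole
  by_cases h : l ∈ Finset.Icc 1 t
  · rw [if_pos h, if_pos h, finrank_top, Module.finrank_fin_fun]
  · rw [if_neg h, if_neg h, finrank_bot]

/-- Every representation is a direct sum of segments. -/
theorem exists_isFrame (A : Rep K t d) :
    ∃ (ι : Type) (_ : Fintype ι) (seg : ι → ℕ × ℕ) (v : ι → ∀ l, Fin (d l) → K),
      IsFrame A (whole K t d) seg v := by
  refine exists_isFrame_of_invariant A _ (fun l y hy => ?_) (fun l hl => by rw [whole, if_neg hl])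
  by_cases h : l ∈ Finset.Ico 1 t
  · rw [whole, if_pos (left_mem h)]; trivial
  · simp [Rep.map, h]

end Frame

/-! ### Consequences of a decomposition into segments -/

section Frame

variable {K : Type*} [Field K] {t : ℕ} {d : ℕ → ℕ} {ι : Type} [Fintype ι]

namespace IsFrame

variable {A : Rep K t d} {U : ∀ l, Submodule K (Fin (d l) → K)} {seg : ι → ℕ × ℕ}
  {v : ι → ∀ l, Fin (d l) → K}

lemma shift_pow (hv : IsFrame A U seg v) (k : ι) (n l : ℕ) :
    (A.shift ^ n) (v k) l = if l + n ≤ (seg k).2 then v k l else 0 := by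
  induction n generalizing l with
  | zero =>
    by_cases h : l ≤ (seg k).2
    · simp [h]
    · simp [h, hv.eq_zero k l (by omega)]
  | succ n ih =>
    rw [pow_succ', Module.End.mul_apply, Rep.shift_apply, ih]
    by_cases h : l + 1 + n ≤ (seg k).2
    · rw [if_pos h, if_pos (by omega), ← Rep.shift_apply, hv.shift, if_pos (by omega)]
    · rw [if_neg h, if_neg (by omega), Matrix.mulVec_zero]

lemma span_subtype (hv : IsFrame A U seg v) (l : ℕ) :
    Submodule.span K (Set.range fun k : {k // (seg k).1 ≤ l ∧ l ≤ (seg k).2} => v k l) = U l := by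
  rw [← hv.span l]
  refine le_antisymm (Submodule.span_mono ?_) (Submodule.span_le.2 ?_)
  · rintro _ ⟨k, rfl⟩
    exact ⟨k.1, rfl⟩
  · rintro _ ⟨k, rfl⟩
    by_cases h : (seg k).1 ≤ l ∧ l ≤ (seg k).2
    · exact Submodule.subset_span ⟨⟨k, h⟩, rfl⟩
    · simp [hv.eq_zero k l h]

lemma linearIndependent (hv : IsFrame A U seg v) (l : ℕ) :
    LinearIndependent K fun k : {k // (seg k).1 ≤ l ∧ l ≤ (seg k).2} => v k l := by
  rw [linearIndependent_iff_card_eq_finrank_span, Set.finrank, hv.span_subtype, ← hv.card,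
    Fintype.card_subtype]

/-- Summands without vertices can be omitted. -/
lemma nonempty (hv : IsFrame A U seg v) :
    IsFrame A U (fun k : {k // (seg k).1 ≤ (seg k).2} => seg k) (fun k => v k) where
  eq_zero k := hv.eq_zero k
  shift k := hv.shift k
  span l := by
    rw [← hv.span l]
    refine le_antisymm (Submodule.span_mono ?_) (Submodule.span_le.2 ?_)
    · rintro _ ⟨k, rfl⟩
      exact ⟨k.1, rfl⟩
    · rintro _ ⟨k, rfl⟩
      by_cases h : (seg k).1 ≤ l ∧ l ≤ (seg k).2
      · exact Submodule.subset_span ⟨⟨k, h.1.trans h.2⟩, rfl⟩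
      · simp [hv.eq_zero k l h]
  card l := by
    rw [← hv.card l]
    refine Finset.card_bij (fun k _ => k.1) (by simp) (fun k _ k' _ h => Subtype.ext h)
      fun k hk => ?_
    simp only [Finset.mem_filter, Finset.mem_univ, true_and] at hk
    exact ⟨⟨k, hk.1.trans hk.2⟩, by simpa using hk, rfl⟩

lemma reindex {κ : Type} [Fintype κ] (hv : IsFrame A U seg v) (e : κ ≃ ι) :
    IsFrame A U (seg ∘ e) (v ∘ e) where
  eq_zero k := hv.eq_zero (e k)
  shift k := hv.shift (e k)
  span l := by
    rw [← hv.span l]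
    congr 1
    exact e.surjective.range_comp fun k => v k l
  card l := by
    rw [← hv.card l]
    exact Finset.card_bij (fun k _ => e k) (by simp) (fun k _ k' _ h => e.injective h)
      fun k hk => ⟨e.symm k, by simpa using hk, by simp⟩

lemma card_whole (hv : IsFrame A (whole K t d) seg v) (l : ℕ) :
    (Finset.univ.filter fun k => (seg k).1 ≤ l ∧ l ≤ (seg k).2).card =
      if l ∈ Finset.Icc 1 t then d l else 0 := by
  rw [hv.card, finrank_whole]

lemma mem_Icc (hv : IsFrame A (whole K t d) seg v) {k : ι} {l : ℕ} (h1 : (seg k).1 ≤ l)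
    (h2 : l ≤ (seg k).2) : l ∈ Finset.Icc 1 t := by
  by_contra h
  have := hv.card_whole l
  rw [if_neg h, Finset.card_eq_zero, Finset.filter_eq_empty_iff] at this
  exact this (Finset.mem_univ k) ⟨h1, h2⟩

/-- The rank of `A_{(i, i+n)}` is the number of summands that contain `[i, i+n]`. -/
lemma rank_comp (hv : IsFrame A (whole K t d) seg v) {i n : ℕ} (hin : i + n ∈ Finset.Icc 1 t) :
    (A.comp i n).rank = (Finset.univ.filter fun k => (seg k).1 ≤ i ∧ i + n ≤ (seg k).2).card := by
  have hcomp : ∀ k, (A.comp i n).mulVecLin (v k (i + n)) =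
      if i + n ≤ (seg k).2 then v k i else 0 := fun k => by
    rw [← hv.shift_pow, Rep.shift_pow_apply]; rfl
  have hrange : LinearMap.range (A.comp i n).mulVecLin = Submodule.span K
      (Set.range fun k : {k // (seg k).1 ≤ i ∧ i + n ≤ (seg k).2} => v k i) := by
    rw [LinearMap.range_eq_map, ← (show whole K t d (i + n) = ⊤ from if_pos hin), ← hv.span,
      Submodule.map_span]
    refine le_antisymm (Submodule.span_le.2 ?_) (Submodule.span_mono ?_)
    · rintro _ ⟨_, ⟨k, rfl⟩, rfl⟩
      simp only [hcomp]
      split_ifs with h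
      · by_cases h' : (seg k).1 ≤ i
        · exact Submodule.subset_span ⟨⟨k, h', h⟩, rfl⟩
        · simp [hv.eq_zero k i (by omega)]
      · exact zero_mem _
    · rintro _ ⟨k, rfl⟩
      exact ⟨_, ⟨k.1, rfl⟩, by rw [hcomp, if_pos k.2.2]⟩
  have hli : LinearIndependent K
      fun k : {k // (seg k).1 ≤ i ∧ i + n ≤ (seg k).2} => v k i :=
    (hv.linearIndependent i).comp
      (fun k : {k // (seg k).1 ≤ i ∧ i + n ≤ (seg k).2} => ⟨k.1, k.2.1, by omega⟩)
      fun k k' h => Subtype.ext (by simpa using h)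
  rw [Matrix.rank, hrange, finrank_span_eq_card hli, Fintype.card_subtype]

/-- The basis of the space at the vertex `l` given by the summands that contain `l`. -/
noncomputable def basis (hv : IsFrame A (whole K t d) seg v) {l : ℕ} (hl : l ∈ Finset.Icc 1 t) :
    Module.Basis {k // (seg k).1 ≤ l ∧ l ≤ (seg k).2} K (Fin (d l) → K) :=
  .mk (hv.linearIndependent l) (by rw [hv.span_subtype, whole, if_pos hl])

lemma basis_apply (hv : IsFrame A (whole K t d) seg v) {l : ℕ} (hl : l ∈ Finset.Icc 1 t)
    (k : {k // (seg k).1 ≤ l ∧ l ≤ (seg k).2}) : hv.basis hl k = v k l := by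
  simp [basis]

lemma map_mulVec (hv : IsFrame A (whole K t d) seg v) {l : ℕ} (hl : l ∈ Finset.Ico 1 t) (k : ι) :
    (A ⟨l, hl⟩).mulVec (v k (l + 1)) = if l + 1 ≤ (seg k).2 then v k l else 0 := by
  rw [← hv.shift, Rep.shift_apply, Rep.map, dif_pos hl]

lemma span_eq_top (hv : IsFrame A (whole K t d) seg v) {l : ℕ} (hl : l ∈ Finset.Icc 1 t) :
    Submodule.span K (Set.range fun k => v k l) = ⊤ := by
  rw [hv.span, whole, if_pos hl]

/-- Representations with the same summands lie in the same orbit. -/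
lemma mem_orbit {B : Rep K t d} {v' : ι → ∀ l, Fin (d l) → K}
    (hv : IsFrame A (whole K t d) seg v) (hv' : IsFrame B (whole K t d) seg v') :
    B ∈ A.orbit := by
  have hg : ∀ l : Finset.Icc 1 t, ∃ g : GL (Fin (d l)) K, ∀ k, g.1.mulVec (v k l) = v' k l := by
    rintro ⟨l, hl⟩
    let e := (hv.basis hl).equiv (hv'.basis hl) (Equiv.refl _)
    refine ⟨⟨LinearMap.toMatrix' e.toLinearMap, LinearMap.toMatrix' e.symm.toLinearMap, ?_, ?_⟩,
      fun k => ?_⟩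
    · rw [← LinearMap.toMatrix'_comp]; simp
    · rw [← LinearMap.toMatrix'_comp]; simp
    · rw [LinearMap.toMatrix'_mulVec]
      by_cases h : (seg k).1 ≤ l ∧ l ≤ (seg k).2
      · rw [← hv.basis_apply hl ⟨k, h⟩, ← hv'.basis_apply hl ⟨k, h⟩]
        simp [e]
      · simp [hv.eq_zero k l h, hv'.eq_zero k l h]
  choose g hg using hg
  refine ⟨g, fun l hl => ?_⟩
  have key : B ⟨l, hl⟩ * (g ⟨l + 1, right_mem hl⟩).1 = (g ⟨l, left_mem hl⟩).1 * A ⟨l, hl⟩ := by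
    apply Matrix.mulVec_injective
    suffices h : (B ⟨l, hl⟩ * (g ⟨l + 1, right_mem hl⟩).1).mulVecLin =
        ((g ⟨l, left_mem hl⟩).1 * A ⟨l, hl⟩).mulVecLin by
      funext x; exact LinearMap.congr_fun h x
    refine LinearMap.ext_on_range (hv.span_eq_top (right_mem hl)) fun k => ?_
    have h1 := hg ⟨l + 1, right_mem hl⟩ k
    have h2 := hg ⟨l, left_mem hl⟩ k
    simp only at h1 h2
    rw [Matrix.mulVecLin_apply, Matrix.mulVecLin_apply, ← Matrix.mulVec_mulVec, h1,
      hv'.map_mulVec hl, ← Matrix.mulVec_mulVec, hv.map_mulVec hl]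
    split_ifs
    · exact h2.symm
    · simp
  rw [← key, Matrix.mul_assoc, ← Units.val_mul, mul_inv_cancel, Units.val_one, Matrix.mul_one]

end IsFrame

/-- Families with the same multiset of values differ by a bijection of their index sets. -/
lemma exists_equiv_of_map_eq {α ι κ : Type} [Fintype ι] [Fintype κ] {f : ι → α} {g : κ → α}
    (h : (Finset.univ.val.map f : Multiset α) = Finset.univ.val.map g) :
    ∃ e : ι ≃ κ, ∀ s, g (e s) = f s := by
  classical
  have hc : ∀ c, Nonempty ({s // f s = c} ≃ {s // g s = c}) := fun c => by
    refine Fintype.card_eq.1 ?_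
    have := congrArg (Multiset.count c) h
    rw [Multiset.count_map, Multiset.count_map] at this
    rw [Fintype.card_subtype, Fintype.card_subtype]
    simpa [Finset.card, Finset.filter, eq_comm] using this
  exact ⟨Equiv.ofFiberEquiv fun c => (hc c).some, fun s => Equiv.ofFiberEquiv_map _ s⟩

/-- The representation `A` is the direct sum of the segments in the multisegment `M`. -/
def HasSummands (A : Rep K t d) (M : Multisegment) : Prop :=
  ∃ (ι : Type) (_ : Fintype ι) (seg : ι → ℕ × ℕ) (v : ι → ∀ l, Fin (d l) → K),
    IsFrame A (whole K t d) seg v ∧ Finset.univ.val.map seg = M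

lemma HasSummands.mem_orbit {A B : Rep K t d} {M : Multisegment} (hA : HasSummands A M)
    (hB : HasSummands B M) : B ∈ A.orbit := by
  obtain ⟨ι, _, seg, v, hv, rfl⟩ := hA
  obtain ⟨κ, _, seg', v', hv', h⟩ := hB
  obtain ⟨e, he⟩ := exists_equiv_of_map_eq h
  have hse : seg ∘ e = seg' := funext he
  have := hv.reindex e
  rw [hse] at this
  exact this.mem_orbit hv'

lemma HasSummands.isoTo {A : Rep K t d} {M : Multisegment} (hA : HasSummands A M) :
    A.IsoTo M := by
  classical
  obtain ⟨ι, _, seg, v, hv, rfl⟩ := hA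
  set M : Multisegment := Finset.univ.val.map seg with hM
  obtain ⟨e, he⟩ := exists_equiv_of_map_eq (f := fun s : M.ToType => s.1) (g := seg)
    (by rw [Multiset.map_univ_coe])
  let ε (l : ℕ) : M.At l ≃ {k // (seg k).1 ≤ l ∧ l ≤ (seg k).2} :=
    e.subtypeEquiv fun s => by rw [he]
  refine ⟨fun l => (hv.basis l.2).equivFun.trans (LinearEquiv.funCongrLeft K K (ε l)), ?_⟩
  intro l hl x
  induction (hv.span_eq_top (right_mem hl) ▸ Submodule.mem_top :
    x ∈ Submodule.span K (Set.range fun k => v k (l + 1))) using Submodule.span_induction with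
  | mem x hx =>
    obtain ⟨k, rfl⟩ := hx
    have hrep (l : ℕ) (hl : l ∈ Finset.Icc 1 t) (k : ι) (s : M.At l) :
        (hv.basis hl).equivFun (v k l) (ε l s) = if e s.1 = k then 1 else 0 := by
      by_cases h : (seg k).1 ≤ l ∧ l ≤ (seg k).2
      · rw [← hv.basis_apply hl ⟨k, h⟩, Module.Basis.equivFun_self]
        simp [ε, Subtype.ext_iff, eq_comm]
      · have hne : e s.1 ≠ k := by rintro rfl; exact h (ε l s).2
        rw [hv.eq_zero k l h, map_zero, if_neg hne]; rfl
    rw [hv.map_mulVec hl]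
    ext s
    have hL : ((hv.basis (left_mem hl)).equivFun.trans (LinearEquiv.funCongrLeft K K (ε l)))
        (if l + 1 ≤ (seg k).2 then v k l else 0) s =
        if l + 1 ≤ (seg k).2 then if e s.1 = k then 1 else 0 else 0 := by
      split_ifs with h1 h2
      · exact (hrep l (left_mem hl) k s).trans (if_pos h2)
      · exact (hrep l (left_mem hl) k s).trans (if_neg h2)
      · simp
    have hR (h : l + 1 ≤ s.1.1.2) : ((hv.basis (right_mem hl)).equivFun.trans
        (LinearEquiv.funCongrLeft K K (ε (l + 1)))) (v k (l + 1))
        ⟨s.1, s.2.1.trans (Nat.le_succ l), h⟩ = if e s.1 = k then 1 else 0 :=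
      hrep (l + 1) (right_mem hl) k ⟨s.1, s.2.1.trans (Nat.le_succ l), h⟩
    refine hL.trans ?_
    simp only [Multisegment.repMap, LinearMap.coe_mk, AddHom.coe_mk]
    by_cases hk : e s.1 = k
    · have hs : s.1.1 = seg k := by rw [← hk, he]
      by_cases h : l + 1 ≤ (seg k).2
      · rw [dif_pos (by rwa [hs]), hR (by rwa [hs]), if_pos h]
      · rw [dif_neg (by rwa [hs]), if_neg h]
    · rw [if_neg hk, ite_self]
      split_ifs with h
      · rw [hR h, if_neg hk]
      · rfl
  | zero => simp
  | add x y _ _ hx hy => simp only [Matrix.mulVec_add, map_add, hx, hy]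
  | smul c x _ hx => simp only [Matrix.mulVec_smul, map_smul, hx]

end Frame

/-! ### Exchange of linked segments -/

/-- Two segments are linked if their union is a segment that is strictly larger than both, the
first of them being the one further to the left. -/
def Linked (s s' : ℕ × ℕ) : Prop := s.1 < s'.1 ∧ s'.1 ≤ s.2 + 1 ∧ s.2 < s'.2

section Exchange

variable {ι : Type}

lemma Linked.ne {seg : ι → ℕ × ℕ} {k₁ k₂ : ι} (h : Linked (seg k₁) (seg k₂)) : k₁ ≠ k₂ := by
  rintro rfl; exact absurd h.1 (lt_irrefl _)

variable [DecidableEq ι]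

/-- The exchange of two linked segments `[a, b]`, `[a', b']` for their intersection `[a', b]` and
their union `[a, b']`. The intersection has no vertices if `a' = b + 1`. -/
def exchange (seg : ι → ℕ × ℕ) (k₁ k₂ : ι) : ι → ℕ × ℕ :=
  Function.update (Function.update seg k₁ ((seg k₂).1, (seg k₁).2)) k₂ ((seg k₁).1, (seg k₂).2)

variable {seg : ι → ℕ × ℕ} {k₁ k₂ : ι}

lemma exchange_left (h : k₁ ≠ k₂) : exchange seg k₁ k₂ k₁ = ((seg k₂).1, (seg k₁).2) := by
  simp [exchange, h]

lemma exchange_right : exchange seg k₁ k₂ k₂ = ((seg k₁).1, (seg k₂).2) := by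
  simp [exchange]

lemma exchange_of_ne {k : ι} (h₁ : k ≠ k₁) (h₂ : k ≠ k₂) : exchange seg k₁ k₂ k = seg k := by
  simp [exchange, h₁, h₂]

lemma sum_exchange [Fintype ι] (h : k₁ ≠ k₂) (f : ℕ × ℕ → ℕ) :
    ∑ k, f (exchange seg k₁ k₂ k) + (f (seg k₁) + f (seg k₂)) =
      ∑ k, f (seg k) + (f ((seg k₂).1, (seg k₁).2) + f ((seg k₁).1, (seg k₂).2)) := by
  have hsplit (g : ι → ℕ) : ∑ k, g k = g k₁ + g k₂ + ∑ k ∈ {k₁, k₂}ᶜ, g k := by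
    rw [← Finset.sum_add_sum_compl {k₁, k₂}, Finset.sum_pair h]
  rw [hsplit (fun k => f (exchange seg k₁ k₂ k)), hsplit (fun k => f (seg k)), exchange_left h,
    exchange_right]
  have : ∑ k ∈ {k₁, k₂}ᶜ, f (exchange seg k₁ k₂ k) = ∑ k ∈ {k₁, k₂}ᶜ, f (seg k) := by
    refine Finset.sum_congr rfl fun k hk => ?_
    simp only [Finset.mem_compl, Finset.mem_insert, Finset.mem_singleton, not_or] at hk
    rw [exchange_of_ne hk.1 hk.2]
  rw [this]; omega

/-- An exchange preserves the dimension vector. -/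
lemma card_exchange [Fintype ι] (h : Linked (seg k₁) (seg k₂)) (l : ℕ) :
    (Finset.univ.filter fun k =>
      (exchange seg k₁ k₂ k).1 ≤ l ∧ l ≤ (exchange seg k₁ k₂ k).2).card =
      (Finset.univ.filter fun k => (seg k).1 ≤ l ∧ l ≤ (seg k).2).card := by
  have := sum_exchange (seg := seg) h.ne fun s => if s.1 ≤ l ∧ l ≤ s.2 then 1 else 0
  rw [Finset.card_filter, Finset.card_filter]
  obtain ⟨h1, h2, h3⟩ := h
  simp only at this
  split_ifs at this <;> omega

/-- An exchange increases the number of segments that contain `[i, j]` exactly if `[i, j]` is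
contained in the union of the two segments but not in one of them. -/
lemma card_exchange_rank [Fintype ι] (h : Linked (seg k₁) (seg k₂)) (i j : ℕ) :
    (Finset.univ.filter fun k =>
      (exchange seg k₁ k₂ k).1 ≤ i ∧ j ≤ (exchange seg k₁ k₂ k).2).card =
      (Finset.univ.filter fun k => (seg k).1 ≤ i ∧ j ≤ (seg k).2).card +
        if ((seg k₁).1 ≤ i ∧ i < (seg k₂).1) ∧ (seg k₁).2 < j ∧ j ≤ (seg k₂).2 then 1 else 0 := by
  have := sum_exchange (seg := seg) h.ne fun s => if s.1 ≤ i ∧ j ≤ s.2 then 1 else 0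
  rw [Finset.card_filter, Finset.card_filter]
  obtain ⟨h1, h2, h3⟩ := h
  simp only at this
  split_ifs at this ⊢ <;> omega

lemma sum_sq_lt_exchange [Fintype ι] (h : Linked (seg k₁) (seg k₂)) :
    ∑ k, ((seg k).2 + 1 - (seg k).1) ^ 2 <
      ∑ k, ((exchange seg k₁ k₂ k).2 + 1 - (exchange seg k₁ k₂ k).1) ^ 2 := by
  have := sum_exchange (seg := seg) h.ne fun s => (s.2 + 1 - s.1) ^ 2
  obtain ⟨h1, h2, h3⟩ := h
  simp only at this
  obtain ⟨x, hx⟩ := Nat.exists_eq_add_of_lt h1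
  obtain ⟨y, hy⟩ := Nat.exists_eq_add_of_le h2
  obtain ⟨z, hz⟩ := Nat.exists_eq_add_of_lt h3
  have e1 : (seg k₁).2 + 1 - (seg k₁).1 = x + 1 + y := by omega
  have e2 : (seg k₂).2 + 1 - (seg k₂).1 = y + z + 1 := by omega
  have e3 : (seg k₁).2 + 1 - (seg k₂).1 = y := by omega
  have e4 : (seg k₂).2 + 1 - (seg k₁).1 = x + 1 + y + z + 1 := by omega
  rw [e1, e2, e3, e4] at this
  nlinarith [Nat.zero_le (x * z)]

end Exchange

section Deformation

variable {K : Type*} [Field K] {t : ℕ} {d : ℕ → ℕ} {ι : Type} [Fintype ι] [DecidableEq ι]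

/-- The deformation of a sum of two linked segments `[a, b] ⊕ [a', b']`: the arrow `b + 1 → b` is
changed by `s` times the map that sends the basis vector of `[a', b']` to the one of `[a, b]`. For
`s ≠ 0` this gives the union and the intersection of the two segments. -/
theorem IsFrame.exists_deformation {A : Rep K t d} {seg : ι → ℕ × ℕ} {v : ι → ∀ l, Fin (d l) → K}
    (hv : IsFrame A (whole K t d) seg v) {k₁ k₂ : ι} (h : Linked (seg k₁) (seg k₂)) :
    ∃ γ : K → Rep K t d, IsRationalCurve 1 γ ∧ γ 0 = A ∧
      ∀ s, s ≠ 0 → ∃ v', IsFrame (γ s) (whole K t d) (exchange seg k₁ k₂) v' := by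
  have hne := h.ne
  have hcard := card_exchange h
  obtain ⟨h1, h2, h3⟩ := h
  set b := (seg k₁).2 with hb
  have hb1 : b + 1 ∈ Finset.Icc 1 t := hv.mem_Icc h2 h3
  have hb0 : b ∈ Finset.Icc 1 t := by
    have : b + 1 ∈ Finset.Icc 1 t := hb1
    by_cases hlt : (seg k₁).1 ≤ b
    · exact hv.mem_Icc hlt le_rfl
    · omega
  have hbo : b ∈ Finset.Ico 1 t := by simp at hb0 hb1 ⊢; omega
  obtain ⟨θ, hθ⟩ : ∃ θ : Module.Dual K (Fin (d (b + 1)) → K), ∀ k,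
      θ (v k (b + 1)) = if k = k₂ then 1 else 0 := by
    refine ⟨(hv.basis hb1).coord ⟨k₂, h2, h3⟩, fun k => ?_⟩
    by_cases hk : (seg k).1 ≤ b + 1 ∧ b + 1 ≤ (seg k).2
    · rw [← hv.basis_apply hb1 ⟨k, hk⟩, Module.Basis.coord_apply, Module.Basis.repr_self,
        Finsupp.single_apply]
      simp
    · rw [hv.eq_zero k _ hk, map_zero, if_neg]
      rintro rfl; exact hk ⟨h2, h3⟩
  let E : ∀ l : ℕ, Matrix (Fin (d l)) (Fin (d (l + 1))) K := fun l =>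
    if hl : l = b then LinearMap.toMatrix' ((hl ▸ θ : Module.Dual K (Fin (d (l + 1)) → K)).smulRight
      (v k₁ l)) else 0
  let γ : K → Rep K t d := fun s l => A l + s • E l
  have hE : ∀ k l, (E l).mulVec (v k (l + 1)) = if l = b ∧ k = k₂ then v k₁ l else 0 := by
    intro k l
    by_cases hl : l = b
    · subst hl
      simp only [E, dif_pos, LinearMap.toMatrix'_mulVec, LinearMap.smulRight_apply, hθ]
      split_ifs with h <;> simp_all
    · simp [E, hl]
  have hshift : ∀ s (w : ∀ l, Fin (d l) → K) l, (γ s).shift w l =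
      A.shift w l + s • (E l).mulVec (w (l + 1)) := by
    intro s w l
    simp only [Rep.shift_apply, Rep.map]
    by_cases hl : l ∈ Finset.Ico 1 t
    · simp only [dif_pos hl, γ, Matrix.add_mulVec, Matrix.smul_mulVec]
    · have : l ≠ b := by rintro rfl; exact hl hbo
      simp [hl, E, this]
  have hvb : ∀ l, b < l → v k₁ l = 0 := fun l hl => hv.eq_zero k₁ l (by omega)
  refine ⟨γ, fun l x y => ⟨.C (A l x y) + .X * .C (E l x y), fun s _ => by simp [γ, mul_comm s]⟩,
    funext fun l => by simp [γ], fun s hs => ?_⟩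
  let w : ∀ l, Fin (d l) → K := fun l => if l ≤ b then v k₂ l else 0
  let v' : ι → ∀ l, Fin (d l) → K :=
    Function.update (Function.update v k₁ w) k₂ (v k₂ + s • v k₁)
  have hv1 : v' k₁ = w := by simp [v', hne]
  have hv2 : v' k₂ = v k₂ + s • v k₁ := by simp [v']
  have hv3 : ∀ k, k ≠ k₁ → k ≠ k₂ → v' k = v k := fun k h h' => by simp [v', h, h']
  refine ⟨v', ?_, ?_, ?_, ?_⟩
  · intro k l hl
    by_cases hk2 : k = k₂
    · subst hk2
      rw [exchange_right] at hl
      rw [hv2, Pi.add_apply, Pi.smul_apply, hv.eq_zero k l (by simp at hl; omega),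
        hv.eq_zero k₁ l (by simp at hl; omega)]
      simp
    by_cases hk1 : k = k₁
    · subst hk1
      rw [exchange_left hne] at hl
      rw [hv1]
      simp only [w]
      split_ifs with h
      · exact hv.eq_zero k₂ l (by simp at hl; omega)
      · rfl
    · rw [exchange_of_ne hk1 hk2] at hl
      rw [hv3 k hk1 hk2, hv.eq_zero k l hl]
  · intro k l
    rw [hshift]
    by_cases hk2 : k = k₂
    · subst hk2
      rw [exchange_right, hv2, map_add, map_smul]
      simp only [Pi.add_apply, Pi.smul_apply, hv.shift, Matrix.mulVec_add, Matrix.mulVec_smul, hE,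
        hne, and_false, and_true, if_false, smul_zero, add_zero]
      by_cases hlb : l = b
      · subst hlb
        rw [if_pos (by omega), if_neg (by omega), if_pos rfl, if_pos (by omega)]
        simp
      · rw [if_neg hlb, smul_zero, add_zero]
        by_cases hl : l + 1 ≤ b
        · rw [if_pos (by omega), if_pos (by omega), if_pos (by omega)]
        · rw [hvb l (by omega)]
          split_ifs <;> simp
    by_cases hk1 : k = k₁
    · subst hk1
      rw [exchange_left hne, hv1]
      have hEw : (E l).mulVec (w (l + 1)) = 0 := by
        by_cases hl : l + 1 ≤ b
        · simp [E, show l ≠ b by omega]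
        · simp [w, hl]
      rw [hEw, smul_zero, add_zero, Rep.shift_apply]
      by_cases hl : l + 1 ≤ b
      · simp only [w, if_pos hl, if_pos (show l ≤ b by omega)]
        rw [← Rep.shift_apply, hv.shift, if_pos (by omega), if_pos (by omega)]
      · simp only [w, if_neg hl, Matrix.mulVec_zero]
        rw [if_neg (by omega)]
    · rw [exchange_of_ne hk1 hk2, hv3 k hk1 hk2, hv.shift, hE,
        if_neg (show ¬ (l = b ∧ k = k₂) from fun h => hk2 h.2), smul_zero, add_zero]
  · intro l
    rw [← hv.span l]
    apply le_antisymm <;> rw [Submodule.span_le]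
    · rintro _ ⟨k, rfl⟩
      have hmem k : v k l ∈ Submodule.span K (Set.range fun k => v k l) :=
        Submodule.subset_span ⟨k, rfl⟩
      simp only [SetLike.mem_coe]
      by_cases hk2 : k = k₂
      · subst hk2
        rw [hv2]
        exact add_mem (hmem _) (Submodule.smul_mem _ _ (hmem _))
      by_cases hk1 : k = k₁
      · subst hk1
        rw [hv1]
        simp only [w]
        split_ifs
        · exact hmem _
        · exact zero_mem _
      · rw [hv3 k hk1 hk2]; exact hmem _
    · rintro _ ⟨k, rfl⟩
      have hmem k : v' k l ∈ Submodule.span K (Set.range fun k => v' k l) :=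
        Submodule.subset_span ⟨k, rfl⟩
      have m1 := hmem k₁
      have m2 := hmem k₂
      simp only [SetLike.mem_coe]
      have h₂ : v k₂ l ∈ Submodule.span K (Set.range fun k => v' k l) := by
        by_cases hl : l ≤ b
        · rw [hv1] at m1
          simpa only [w, if_pos hl] using m1
        · rw [hv2, Pi.add_apply, Pi.smul_apply, hvb l (by omega), smul_zero, add_zero] at m2
          exact m2
      by_cases hk2 : k = k₂
      · rw [hk2]; exact h₂
      by_cases hk1 : k = k₁
      · rw [hk1]
        rw [hv2, Pi.add_apply, Pi.smul_apply] at m2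
        have := Submodule.smul_mem _ s⁻¹ ((Submodule.add_mem_iff_right _ h₂).1 m2)
        rwa [inv_smul_smul₀ hs] at this
      · rw [← hv3 k hk1 hk2]; exact hmem k
  · intro l
    rw [hcard l, hv.card]

end Deformation

/-! ### Families of segments that admit no exchange -/

section Combinatorics

variable {ι : Type} [Fintype ι]

/-- In the family of segments `[a k, b k]` with dimension vector `D`, every linked pair involves
one of the members `k₁` and `k₂`, which are the segments `[p, j - 1]` and `[i + 1, q]` where
`[p, q]` is the largest segment containing `[i, j]` with `m ≤ D` on `[p, i]` and on `[j, q]`. The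
endpoints are integers so that the notion is invariant under the reflection `l ↦ -l`. -/
structure IsBroken (a b : ι → ℤ) (D : ℤ → ℕ) (i j : ℤ) (m : ℕ) (k₁ k₂ : ι) : Prop where
  left_le : a k₁ ≤ i
  left_end : b k₁ = j - 1
  right_start : a k₂ = i + 1
  le_right : j ≤ b k₂
  le_left_dim : ∀ l, a k₁ ≤ l → l ≤ i → m ≤ D l
  left_dim_lt : D (a k₁ - 1) < m
  le_right_dim : ∀ l, j ≤ l → l ≤ b k₂ → m ≤ D l
  right_dim_lt : D (b k₂ + 1) < m
  linked : ∀ k k', a k < a k' → a k' ≤ b k + 1 → b k < b k' → k = k₁ ∨ k' = k₂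

/-- Consider a family in which fewer than `m = min (D i) (D j)` members contain `[i, j]`, but in
which each exchange of a linked pair makes this number equal to `m`. If `D i ≤ D j`, exactly
one member `k₁` contains `i` but not `j`. The member `k₂` is a longest one of those that contain `j`
but not `i`. All assertions follow by comparing the numbers of members through two vertices: a
surplus at one of them provides a member that would form a forbidden linked pair. -/
theorem exists_isBroken_of_left {a b : ι → ℤ} {D : ℤ → ℕ} {i j : ℤ} {m : ℕ}
    (hD : ∀ l, (Finset.univ.filter fun k => a k ≤ l ∧ l ≤ b k).card = D l)
    (hr : (Finset.univ.filter fun k => a k ≤ i ∧ j ≤ b k).card < m)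
    (H : ∀ k k', a k < a k' → a k' ≤ b k + 1 → b k < b k' →
      (Finset.univ.filter fun k => a k ≤ i ∧ j ≤ b k).card + 1 = m ∧ a k ≤ i ∧ i < a k' ∧
        b k < j ∧ j ≤ b k')
    (hi : D i = m) (hj : m ≤ D j) (hl : ∀ l, i < l → l < j → D j < D l) :
    ∃ k₁ k₂, IsBroken a b D i j m k₁ k₂ := by
  classical
  set S : ℤ → Finset ι := fun l => Finset.univ.filter fun k => a k ≤ l ∧ l ≤ b k with hS
  set R : Finset ι := Finset.univ.filter fun k => a k ≤ i ∧ j ≤ b k with hR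
  have mS : ∀ {k l}, k ∈ S l ↔ a k ≤ l ∧ l ≤ b k := by simp [hS]
  have mR : ∀ {k}, k ∈ R ↔ a k ≤ i ∧ j ≤ b k := by simp [hR]
  have hD : ∀ l, (S l).card = D l := hD
  -- the member `k₁` that contains `i` but not `j`
  obtain ⟨k₁, hk₁, hk₁R⟩ := Finset.exists_mem_notMem_of_card_lt_card (s := R) (t := S i)
    (by rw [hD, hi]; exact hr)
  rw [mS] at hk₁
  rw [mR] at hk₁R
  have hb₁ : b k₁ < j := by omega
  -- it is linked to some other member, so exactly `m - 1` members contain `[i, j]`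
  have hRm : R.card + 1 = m := by
    have hcard : D i ≤ D (b k₁ + 1) := by
      rcases eq_or_lt_of_le (show b k₁ + 1 ≤ j by omega) with h | h
      · rw [h]; omega
      · have := hl (b k₁ + 1) (by omega) h; omega
    obtain ⟨x, hx, hxi⟩ := Finset.exists_mem_notMem_of_card_lt_card
      (s := (S i).erase k₁) (t := S (b k₁ + 1)) (by
        rw [Finset.card_erase_of_mem (mS.2 hk₁), hD, hD]; omega)
    rw [mS] at hx
    rw [Finset.mem_erase, mS] at hxi
    have hne : x ≠ k₁ := by rintro rfl; omega
    have hxi : ¬ (a x ≤ i ∧ i ≤ b x) := fun h => hxi ⟨hne, h⟩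
    exact (H k₁ x (by omega) (by omega) (by omega)).1
  have huniq : ∀ x, a x ≤ i → i ≤ b x → b x < j → x = k₁ := by
    intro x h1 h2 h3
    by_contra hne
    have hsub : insert x (insert k₁ R) ⊆ S i := by
      intro y hy
      simp only [Finset.mem_insert, mR] at hy
      rw [mS]
      rcases hy with rfl | rfl | hy <;> omega
    have := Finset.card_le_card hsub
    rw [Finset.card_insert_of_notMem (by
        rw [Finset.mem_insert, mR]; exact not_or.2 ⟨hne, by omega⟩),
      Finset.card_insert_of_notMem (by rw [mR]; omega), hD, hi] at this
    omega
  have hb₁' : b k₁ = j - 1 := by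
    by_contra hne
    have h1 := hl (b k₁ + 1) (by omega) (by omega)
    obtain ⟨x, hx, hxj⟩ := Finset.exists_mem_notMem_of_card_lt_card
      (s := S j) (t := S (b k₁ + 1)) (by rw [hD, hD]; exact h1)
    rw [mS] at hx hxj
    have hxi : ¬ a x ≤ i := fun h => by
      have := huniq x h (by omega) (by omega)
      subst this; omega
    have := H k₁ x (by omega) (by omega) (by omega)
    omega
  -- the members that contain `j` but not `i` all start at `i + 1`; `k₂` is one of maximal length
  have hstart : ∀ x, i < a x → a x ≤ j → j ≤ b x → a x = i + 1 := by
    intro x h1 h2 h3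
    by_contra hne
    have hlt := hl (a x - 1) (by omega) (by omega)
    obtain ⟨y, hy, hyj⟩ := Finset.exists_mem_notMem_of_card_lt_card
      (s := insert k₁ ((S j).erase x)) (t := S (a x - 1)) (by
        have := Finset.card_insert_le k₁ ((S j).erase x)
        rw [Finset.card_erase_of_mem (mS.2 ⟨h2, h3⟩), hD] at this
        have : 0 < D j := by rw [← hD]; exact Finset.card_pos.2 ⟨x, mS.2 ⟨h2, h3⟩⟩
        rw [hD]; omega)
    rw [mS] at hy
    simp only [Finset.mem_insert, Finset.mem_erase, mS, not_or, not_and] at hyj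
    have hyx : y ≠ x := by rintro rfl; omega
    have hyj' := hyj.2 hyx
    have := H y x (by omega) (by omega) (by omega)
    exact hyj.1 (huniq y (by omega) (by omega) (by omega))
  obtain ⟨k₂, hk₂, hmax⟩ := Finset.exists_max_image ((S j) \ R) b (by
    obtain ⟨x, hx, hxR⟩ := Finset.exists_mem_notMem_of_card_lt_card (s := R) (t := S j)
      (by rw [hD]; omega)
    exact ⟨x, Finset.mem_sdiff.2 ⟨hx, hxR⟩⟩)
  simp only [Finset.mem_sdiff, mS, mR] at hk₂ hmax
  have ha₂ : a k₂ = i + 1 := hstart k₂ (by omega) (by omega) (by omega)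
  have hk₂R : k₂ ∉ R := by rw [mR]; omega
  have hk₁R' : k₁ ∉ R := by rw [mR]; omega
  refine ⟨k₁, k₂, hk₁.1, hb₁', ha₂, by omega, ?_, ?_, ?_, ?_, ?_⟩
  · intro l h1 h2
    rw [← hD, ← hRm, ← Finset.card_insert_of_notMem hk₁R']
    refine Finset.card_le_card fun x hx => ?_
    simp only [Finset.mem_insert, mR] at hx
    rw [mS]
    rcases hx with rfl | hx
    · omega
    · have := H k₁ x
      omega
  · by_contra hlt
    obtain ⟨x, hx, hxi⟩ := Finset.exists_mem_notMem_of_card_lt_card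
      (s := R) (t := S (a k₁ - 1)) (by rw [hD]; omega)
    rw [mS] at hx
    rw [mR] at hxi
    have h1 := huniq x
    have h2 := H x k₁
    have hne : x ≠ k₁ := by rintro rfl; omega
    have : ¬ (a x ≤ i ∧ i ≤ b x ∧ b x < j) := fun h => hne (h1 h.1 h.2.1 h.2.2)
    omega
  · intro l h1 h2
    rw [← hD, ← hRm, ← Finset.card_insert_of_notMem hk₂R]
    refine Finset.card_le_card fun x hx => ?_
    simp only [Finset.mem_insert, mR] at hx
    rw [mS]
    rcases hx with rfl | hx
    · omega
    · have := H x k₂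
      omega
  · by_contra hlt
    obtain ⟨x, hx, hxi⟩ := Finset.exists_mem_notMem_of_card_lt_card
      (s := R) (t := S (b k₂ + 1)) (by rw [hD]; omega)
    rw [mS] at hx
    rw [mR] at hxi
    have h1 := H k₂ x
    have h2 := hmax x
    omega
  · intro k k' h1 h2 h3
    obtain ⟨-, h4, h5, h6, h7⟩ := H k k' h1 h2 h3
    exact .inl (huniq k h4 (by omega) h6)

/-- The case `D j ≤ D i` is the mirror image of the case `D i ≤ D j`. -/
theorem exists_isBroken {a b : ι → ℤ} {D : ℤ → ℕ} {i j : ℤ} {m : ℕ}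
    (hD : ∀ l, (Finset.univ.filter fun k => a k ≤ l ∧ l ≤ b k).card = D l)
    (hr : (Finset.univ.filter fun k => a k ≤ i ∧ j ≤ b k).card < m)
    (H : ∀ k k', a k < a k' → a k' ≤ b k + 1 → b k < b k' →
      (Finset.univ.filter fun k => a k ≤ i ∧ j ≤ b k).card + 1 = m ∧ a k ≤ i ∧ i < a k' ∧
        b k < j ∧ j ≤ b k')
    (hm : min (D i) (D j) = m) (hl : ∀ l, i < l → l < j → max (D i) (D j) < D l) :
    ∃ k₁ k₂, IsBroken a b D i j m k₁ k₂ := by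
  rcases le_total (D i) (D j) with h | h
  · rw [min_eq_left h] at hm
    rw [max_eq_right h] at hl
    exact exists_isBroken_of_left hD hr H hm (by omega) hl
  · rw [min_eq_right h] at hm
    rw [max_eq_left h] at hl
    have hR : (Finset.univ.filter fun k => -b k ≤ -j ∧ -i ≤ -a k) =
        Finset.univ.filter fun k => a k ≤ i ∧ j ≤ b k := by
      refine Finset.filter_congr fun k _ => ?_
      omega
    obtain ⟨k₁, k₂, hk⟩ := exists_isBroken_of_left (a := fun k => -b k) (b := fun k => -a k)
      (D := fun l => D (-l)) (i := -j) (j := -i) (m := m)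
      (fun l => by
        rw [← hD (-l)]
        congr 1
        refine Finset.filter_congr fun k _ => ?_
        omega)
      (by rwa [hR])
      (fun k k' h1 h2 h3 => by
        have := H k' k (by omega) (by omega) (by omega)
        rw [hR]; omega)
      (by simpa using hm) (by simp only [neg_neg]; omega)
      (fun l h1 h2 => by simpa using hl (-l) (by omega) (by omega))
    refine ⟨k₂, k₁, ?_, ?_, ?_, ?_, ?_, ?_, ?_, ?_, ?_⟩
    · have := hk.le_right; omega
    · have := hk.right_start; omega
    · have := hk.left_end; omega
    · have := hk.left_le; omega
    · intro l h1 h2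
      simpa using hk.le_right_dim (-l) (by omega) (by omega)
    · have := hk.right_dim_lt
      rwa [show -(-a k₂ + 1) = a k₂ - 1 by omega] at this
    · intro l h1 h2
      simpa using hk.le_left_dim (-l) (by omega) (by omega)
    · have := hk.left_dim_lt
      rwa [show -(-b k₁ - 1) = b k₁ + 1 by omega] at this
    · intro k k' h1 h2 h3
      exact (hk.linked k' k (by omega) (by omega) (by omega)).symm

end Combinatorics

/-! ### Unlinked multisegments -/

namespace Multisegment

/-- All summands have vertices and no two of them are linked. -/
structure Unlinked (M : Multisegment) : Prop where
  le : ∀ s ∈ M, s.1 ≤ s.2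
  not_linked : ∀ s ∈ M, ∀ s' ∈ M, ¬ Linked s s'

lemma Unlinked.mono {M N : Multisegment} (hN : N.Unlinked) (h : M ≤ N) : M.Unlinked :=
  ⟨fun s hs => hN.le s (Multiset.mem_of_le h hs), fun s hs s' hs' =>
    hN.not_linked s (Multiset.mem_of_le h hs) s' (Multiset.mem_of_le h hs')⟩

lemma dim_add (M N : Multisegment) (l : ℕ) : dim (M + N) l = dim M l + dim N l :=
  Multiset.countP_add _ _ _

lemma dim_cons (s : ℕ × ℕ) (M : Multisegment) (l : ℕ) :
    dim (s ::ₘ M) l = dim M l + if s.1 ≤ l ∧ l ≤ s.2 then 1 else 0 :=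
  Multiset.countP_cons _ _ _

lemma dim_pos {M : Multisegment} {l : ℕ} : 0 < dim M l ↔ ∃ s ∈ M, s.1 ≤ l ∧ l ≤ s.2 :=
  Multiset.countP_pos

lemma dim_eq_zero {M : Multisegment} {l : ℕ} :
    dim M l = 0 ↔ ∀ s ∈ M, ¬ (s.1 ≤ l ∧ l ≤ s.2) :=
  Multiset.countP_eq_zero

lemma dim_map {ι : Type} (S : Finset ι) (seg : ι → ℕ × ℕ) (l : ℕ) :
    dim (S.val.map seg) l = (S.filter fun k => (seg k).1 ≤ l ∧ l ≤ (seg k).2).card :=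
  Multiset.countP_map _ _ _

/-- The connected components of the support of the dimension vector of an unlinked multisegment
are summands of it. -/
lemma Unlinked.mem_of_support {M : Multisegment} (hM : M.Unlinked) {x y : ℕ} (hxy : x ≤ y)
    (hpos : ∀ l, x ≤ l → l ≤ y → 0 < M.dim l) (hx : x = 0 ∨ M.dim (x - 1) = 0)
    (hy : M.dim (y + 1) = 0) : (x, y) ∈ M := by
  -- the longest summand that starts at `x`
  obtain ⟨s, hs, hmax⟩ := Finset.exists_max_image
    (M.toFinset.filter fun s => s.1 ≤ x ∧ x ≤ s.2) Prod.snd (by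
      obtain ⟨s, hs, h⟩ := dim_pos.1 (hpos x le_rfl hxy)
      exact ⟨s, by simpa [hs] using h⟩)
  simp only [Finset.mem_filter, Multiset.mem_toFinset] at hs hmax
  obtain ⟨hsM, h1, h2⟩ := hs
  have h3 : s.1 = x := by
    rcases hx with rfl | hx
    · omega
    · have := dim_eq_zero.1 hx s hsM
      omega
  have h4 := dim_eq_zero.1 hy s hsM
  have h5 : s.2 = y := by
    by_contra hne
    obtain ⟨s', hs', h6⟩ := dim_pos.1 (hpos (s.2 + 1) (by omega) (by omega))
    have h7 := hM.not_linked s hsM s' hs'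
    have h8 : s'.1 ≤ x ∧ x ≤ s'.2 → s'.2 ≤ s.2 := fun h => hmax s' ⟨hs', h⟩
    simp only [Linked] at h7
    omega
  rwa [← h3, ← h5]

/-- An unlinked multisegment is determined by its dimension vector. -/
theorem Unlinked.eq_of_dim_eq {M N : Multisegment} (hM : M.Unlinked) (hN : N.Unlinked)
    (h : ∀ l, M.dim l = N.dim l) : M = N := by
  induction hc : M.card generalizing M N with
  | zero =>
    obtain rfl := Multiset.card_eq_zero.1 hc
    refine (Multiset.eq_zero_of_forall_notMem fun s hs => ?_).symm
    have : 0 < N.dim s.1 := dim_pos.2 ⟨s, hs, le_rfl, hN.le s hs⟩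
    rw [← h] at this
    simp [dim] at this
  | succ n ih =>
    -- a longest summand of `M` is a connected component of the support
    obtain ⟨s, hs, hmax⟩ := Finset.exists_max_image M.toFinset (fun s => s.2 - s.1) (by
      obtain ⟨s, hs⟩ := Multiset.card_pos_iff_exists_mem.1 (by omega : 0 < M.card)
      exact ⟨s, by simpa using hs⟩)
    simp only [Multiset.mem_toFinset] at hs hmax
    have hle := hM.le s hs
    have hsN : s ∈ N := by
      refine hN.mem_of_support hle (fun l h1 h2 => ?_) ?_ ?_
      · rw [← h]
        exact dim_pos.2 ⟨s, hs, h1, h2⟩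
      · rw [or_iff_not_imp_left]
        intro h0
        rw [← h, dim_eq_zero]
        intro s' hs' h1
        have h2 := hmax s' hs'
        have h3 := hM.not_linked s' hs' s hs
        simp only [Linked] at h3
        omega
      · rw [← h, dim_eq_zero]
        intro s' hs' h1
        have h2 := hmax s' hs'
        have h3 := hM.not_linked s hs s' hs'
        simp only [Linked] at h3
        omega
    obtain ⟨M', rfl⟩ := Multiset.exists_cons_of_mem hs
    obtain ⟨N', rfl⟩ := Multiset.exists_cons_of_mem hsN
    rw [ih (hM.mono (Multiset.le_cons_self _ _)) (hN.mono (Multiset.le_cons_self _ _))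
      (fun l => by simpa [dim_cons] using h l) (by simpa using hc)]

end Multisegment

open Multisegment

/-- The row `h` of the diagram that defines `generic t d`. -/
def row (t : ℕ) (d : ℕ → ℕ) (h : ℕ) : Finset (ℕ × ℕ) :=
  (Finset.Icc 1 t ×ˢ Finset.Icc 1 t).filter fun s : ℕ × ℕ =>
    s.1 ≤ s.2 ∧ (∀ l ∈ Finset.Icc s.1 s.2, h ≤ d l) ∧
      (s.1 = 1 ∨ d (s.1 - 1) < h) ∧ (s.2 = t ∨ d (s.2 + 1) < h)

lemma mem_row {t : ℕ} {d : ℕ → ℕ} {h : ℕ} {s : ℕ × ℕ} : s ∈ row t d h ↔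
    1 ≤ s.1 ∧ s.1 ≤ s.2 ∧ s.2 ≤ t ∧ (∀ l, s.1 ≤ l → l ≤ s.2 → h ≤ d l) ∧
      (s.1 = 1 ∨ d (s.1 - 1) < h) ∧ (s.2 = t ∨ d (s.2 + 1) < h) := by
  simp only [row, Finset.mem_filter, Finset.mem_product, Finset.mem_Icc, and_imp]
  constructor
  · rintro ⟨⟨⟨h1, h2⟩, h3, h4⟩, h5, h6, h7, h8⟩
    exact ⟨h1, h5, h4, h6, h7, h8⟩
  · rintro ⟨h1, h2, h3, h4, h5, h6⟩
    exact ⟨⟨⟨h1, h2.trans h3⟩, h1.trans h2, h3⟩, h2, h4, h5, h6⟩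

lemma generic_eq_sum_row (t : ℕ) (d : ℕ → ℕ) :
    generic t d = ∑ h ∈ Finset.Icc 1 ((Finset.Icc 1 t).sup d), (row t d h).val := rfl

lemma mem_generic {t : ℕ} {d : ℕ → ℕ} {s : ℕ × ℕ} (hs : s ∈ generic t d) :
    ∃ h, s ∈ row t d h := by
  rw [generic_eq_sum_row, Multiset.mem_sum] at hs
  obtain ⟨h, -, hs⟩ := hs
  exact ⟨h, hs⟩

lemma unlinked_generic (t : ℕ) (d : ℕ → ℕ) : (generic t d).Unlinked := by
  refine ⟨fun s hs => ?_, fun s hs s' hs' hl => ?_⟩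
  · obtain ⟨h, hs⟩ := mem_generic hs
    exact (mem_row.1 hs).2.1
  · obtain ⟨h, hs⟩ := mem_generic hs
    obtain ⟨h', hs'⟩ := mem_generic hs'
    obtain ⟨h1, h2, h3, h4, -, h5⟩ := mem_row.1 hs
    obtain ⟨h1', h2', h3', h4', h5', -⟩ := mem_row.1 hs'
    obtain ⟨l1, l2, l3⟩ := hl
    rcases le_total h h' with hh | hh
    · have := h4' (s.2 + 1) l2 l3
      omega
    · have := h4 (s'.1 - 1) (by omega) (by omega)
      omega

lemma card_row_filter {t : ℕ} {d : ℕ → ℕ} {h l : ℕ} (hl : l ∈ Finset.Icc 1 t) :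
    ((row t d h).filter fun s => s.1 ≤ l ∧ l ≤ s.2).card = if h ≤ d l then 1 else 0 := by
  rw [Finset.mem_Icc] at hl
  split_ifs with hd
  · obtain ⟨x, hx, hxmin⟩ : ∃ x, (1 ≤ x ∧ x ≤ l ∧ ∀ y, x ≤ y → y ≤ l → h ≤ d y) ∧
        ∀ z, (1 ≤ z ∧ z ≤ l ∧ ∀ y, z ≤ y → y ≤ l → h ≤ d y) → x ≤ z := by
      classical
      have hex : ∃ x, 1 ≤ x ∧ x ≤ l ∧ ∀ y, x ≤ y → y ≤ l → h ≤ d y :=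
        ⟨l, hl.1, le_rfl, fun y h1 h2 => by rwa [le_antisymm h2 h1]⟩
      exact ⟨Nat.find hex, Nat.find_spec hex, fun z hz => Nat.find_min' hex hz⟩
    obtain ⟨z, hz, hzmax⟩ : ∃ z, (l ≤ z ∧ z ≤ t ∧ ∀ y, l ≤ y → y ≤ z → h ≤ d y) ∧
        ∀ w, (l ≤ w ∧ w ≤ t ∧ ∀ y, l ≤ y → y ≤ w → h ≤ d y) → w ≤ z := by
      classical
      have hl' : l ≤ l ∧ l ≤ t ∧ ∀ y, l ≤ y → y ≤ l → h ≤ d y :=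
        ⟨le_rfl, hl.2, fun y h1 h2 => by rwa [le_antisymm h2 h1]⟩
      exact ⟨Nat.findGreatest (fun z => l ≤ z ∧ z ≤ t ∧ ∀ y, l ≤ y → y ≤ z → h ≤ d y) t,
        Nat.findGreatest_spec (P := fun z => l ≤ z ∧ z ≤ t ∧ ∀ y, l ≤ y → y ≤ z → h ≤ d y) hl.2 hl',
        fun w hw => Nat.le_findGreatest hw.2.1 hw⟩
    rw [Finset.card_eq_one]
    refine ⟨(x, z), ?_⟩
    ext ⟨p, q⟩
    simp only [Finset.mem_filter, mem_row, Finset.mem_singleton, Prod.mk.injEq]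
    constructor
    · rintro ⟨⟨h1, h2, h3, h4, h5, h6⟩, h7, h8⟩
      have e1 := hxmin p ⟨h1, h7, fun y h9 h10 => h4 y h9 (by omega)⟩
      have e2 := hzmax q ⟨h8, h3, fun y h9 h10 => h4 y (by omega) h10⟩
      constructor
      · by_contra hne
        have := hx.2.2 (p - 1) (by omega) (by omega)
        omega
      · by_contra hne
        have := hz.2.2 (q + 1) (by omega) (by omega)
        omega
    · rintro ⟨rfl, rfl⟩
      refine ⟨⟨hx.1, by omega, hz.2.1, fun y h1 h2 => ?_, ?_, ?_⟩, hx.2.1, hz.1⟩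
      · rcases le_total y l with h3 | h3
        · exact hx.2.2 y h1 h3
        · exact hz.2.2 y h3 h2
      · by_contra! hcon
        have := hxmin (p - 1) ⟨by omega, by omega, fun y h1 h2 => by
          rcases eq_or_lt_of_le h1 with rfl | h1
          · exact hcon.2
          · exact hx.2.2 y (by omega) h2⟩
        omega
      · by_contra! hcon
        have := hzmax (q + 1) ⟨by omega, by omega, fun y h1 h2 => by
          rcases eq_or_lt_of_le h2 with rfl | h2
          · exact hcon.2
          · exact hz.2.2 y h1 (by omega)⟩
        omega
  · rw [Finset.card_eq_zero, Finset.filter_eq_empty_iff]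
    rintro s hs ⟨h1, h2⟩
    exact hd ((mem_row.1 hs).2.2.2.1 l h1 h2)

lemma dim_generic (t : ℕ) (d : ℕ → ℕ) (l : ℕ) :
    (generic t d).dim l = if l ∈ Finset.Icc 1 t then d l else 0 := by
  by_cases hl : l ∈ Finset.Icc 1 t
  · have hsum : (generic t d).dim l = ∑ h ∈ Finset.Icc 1 ((Finset.Icc 1 t).sup d),
        ((row t d h).filter fun s => s.1 ≤ l ∧ l ≤ s.2).card := by
      rw [generic_eq_sum_row]
      have := map_sum (Multiset.countPAddMonoidHom fun s : ℕ × ℕ => s.1 ≤ l ∧ l ≤ s.2)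
        (fun h => (row t d h).val) (Finset.Icc 1 ((Finset.Icc 1 t).sup d))
      simp only [Multiset.coe_countPAddMonoidHom] at this
      rw [dim, this]
      exact Finset.sum_congr rfl fun h _ => Multiset.countP_eq_card_filter _ _
    rw [hsum, if_pos hl, Finset.sum_congr rfl fun h _ => card_row_filter hl,
      ← Finset.card_filter]
    have : (Finset.Icc 1 ((Finset.Icc 1 t).sup d)).filter (fun h => h ≤ d l) =
        Finset.Icc 1 (d l) := by
      have hle : d l ≤ (Finset.Icc 1 t).sup d := Finset.le_sup hl
      ext h
      simp only [Finset.mem_filter, Finset.mem_Icc]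
      omega
    rw [this, Nat.card_Icc]; omega
  · rw [if_neg hl, dim_eq_zero]
    rintro s hs ⟨h1, h2⟩
    obtain ⟨h, hs⟩ := mem_generic hs
    obtain ⟨h3, -, h4, -⟩ := mem_row.1 hs
    exact hl (Finset.mem_Icc.2 ⟨by omega, by omega⟩)

/-- The multisegment `M(d)` only depends on the values of `d` on `[1, t]`. -/
lemma generic_congr {t : ℕ} {d d' : ℕ → ℕ} (h : ∀ l ∈ Finset.Icc 1 t, d l = d' l) :
    generic t d = generic t d' := by
  refine (unlinked_generic t d).eq_of_dim_eq (unlinked_generic t d') fun l => ?_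
  rw [dim_generic, dim_generic]
  split_ifs with hl
  · exact h l hl
  · rfl

lemma leftEnd_eq {d : ℕ → ℕ} {i j p : ℕ} (hp : 1 ≤ p) (hpi : p ≤ i)
    (h : ∀ l, p ≤ l → l ≤ i → min (d i) (d j) ≤ d l)
    (hlt : p = 1 ∨ d (p - 1) < min (d i) (d j)) : leftEnd d i j = p := by
  refine le_antisymm (Nat.sInf_le ⟨hp, hpi, h⟩) (le_csInf ⟨p, hp, hpi, h⟩ ?_)
  rintro x ⟨h1, -, h2⟩
  by_contra hx
  have := h2 (p - 1) (by omega) (by omega)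
  omega

lemma rightEnd_eq {t : ℕ} {d : ℕ → ℕ} {i j q : ℕ} (hq : q ≤ t) (hjq : j ≤ q)
    (h : ∀ l, j ≤ l → l ≤ q → min (d i) (d j) ≤ d l)
    (hlt : q = t ∨ d (q + 1) < min (d i) (d j)) : rightEnd t d i j = q := by
  refine le_antisymm (csSup_le ⟨q, hjq, hq, h⟩ ?_) (le_csSup ⟨t, fun x hx => hx.2.1⟩ ⟨hjq, hq, h⟩)
  rintro x ⟨-, h1, h2⟩
  by_contra hx
  have := h2 (q + 1) (by omega) (by omega)
  omega

/-- A family of segments with dimension vector `d`, of which less than `min (d i) (d j)` contain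
`[i, j]`, and which cannot be improved by an exchange, is the multisegment `almostGeneric`. -/
theorem map_eq_almostGeneric {κ : Type} [Fintype κ] {seg : κ → ℕ × ℕ} {t : ℕ} {d : ℕ → ℕ}
    {i j : ℕ} (hij : (i, j) ∈ J t d) (hi : 0 < d i) (hj : 0 < d j)
    (hne : ∀ k, (seg k).1 ≤ (seg k).2)
    (hdim : ∀ l, (Finset.univ.filter fun k => (seg k).1 ≤ l ∧ l ≤ (seg k).2).card =
      if l ∈ Finset.Icc 1 t then d l else 0)
    (hr : (Finset.univ.filter fun k => (seg k).1 ≤ i ∧ j ≤ (seg k).2).card < min (d i) (d j))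
    (H : ∀ k k', Linked (seg k) (seg k') →
      (Finset.univ.filter fun k => (seg k).1 ≤ i ∧ j ≤ (seg k).2).card + 1 = min (d i) (d j) ∧
        ((seg k).1 ≤ i ∧ i < (seg k').1) ∧ (seg k).2 < j ∧ j ≤ (seg k').2) :
    Finset.univ.val.map seg = almostGeneric t d i j := by
  classical
  obtain ⟨hi1, hij', hjt, hl⟩ := hij
  simp only at hi1 hij' hjt hl
  have hmem : ∀ k l, (seg k).1 ≤ l → l ≤ (seg k).2 → 1 ≤ l ∧ l ≤ t := by
    intro k l h1 h2
    by_contra h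
    have := hdim l
    rw [if_neg (by simpa using h), Finset.card_eq_zero, Finset.filter_eq_empty_iff] at this
    exact this (Finset.mem_univ k) ⟨h1, h2⟩
  let D : ℤ → ℕ := fun l => if 1 ≤ l ∧ l ≤ t then d l.toNat else 0
  have hDn : ∀ l : ℕ, 1 ≤ l → l ≤ t → D l = d l := fun l h1 h2 => by
    simp only [D]
    rw [if_pos (by omega), Int.toNat_natCast]
  have hR : (Finset.univ.filter fun k => ((seg k).1 : ℤ) ≤ i ∧ (j : ℤ) ≤ (seg k).2) =
      Finset.univ.filter fun k => (seg k).1 ≤ i ∧ j ≤ (seg k).2 :=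
    Finset.filter_congr fun k _ => by omega
  obtain ⟨k₁, k₂, hk⟩ := exists_isBroken (a := fun k => ((seg k).1 : ℤ))
    (b := fun k => ((seg k).2 : ℤ)) (D := D) (i := i) (j := j) (m := min (d i) (d j))
    (fun l => by
      rcases lt_or_ge l 0 with h | h
      · simp only [D]
        rw [if_neg (by omega), Finset.card_eq_zero, Finset.filter_eq_empty_iff]
        rintro k -
        omega
      · lift l to ℕ using h
        simp only [D, Nat.cast_le, Int.toNat_natCast, hdim, Finset.mem_Icc, Nat.one_le_cast])
    (by rwa [hR])
    (fun k k' h1 h2 h3 => by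
      have := H k k' ⟨by omega, by omega, by omega⟩
      rw [hR]; omega)
    (by rw [hDn i hi1 (by omega), hDn j (by omega) hjt])
    (fun l h1 h2 => by
      lift l to ℕ using by omega
      rw [hDn i hi1 (by omega), hDn j (by omega) hjt, hDn l (by omega) (by omega)]
      exact hl l (by omega) (by omega))
  have hm0 : 0 < min (d i) (d j) := lt_min hi hj
  obtain ⟨g1, g2, g3, g4, g5, g6, g7, g8, g9⟩ := hk
  have b1 := hmem k₁ _ le_rfl (hne k₁)
  have b2 := hmem k₁ _ (hne k₁) le_rfl
  have b3 := hmem k₂ _ le_rfl (hne k₂)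
  have b4 := hmem k₂ _ (hne k₂) le_rfl
  have hleft : leftEnd d i j = (seg k₁).1 := by
    refine leftEnd_eq b1.1 (by omega) (fun l h1 h2 => ?_) ?_
    · rw [← hDn l (by omega) (by omega)]
      exact g5 l (by omega) (by omega)
    · rw [or_iff_not_imp_left]
      intro h
      rw [← hDn _ (by omega) (by omega), Nat.cast_sub b1.1]
      exact g6
  have hright : rightEnd t d i j = (seg k₂).2 := by
    refine rightEnd_eq b4.2 (by omega) (fun l h1 h2 => ?_) ?_
    · rw [← hDn l (by omega) (by omega)]
      exact g7 l (by omega) (by omega)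
    · rw [or_iff_not_imp_left]
      intro h
      rw [← hDn _ (by omega) (by omega), Nat.cast_add]
      exact g8
  have hs1 : seg k₁ = (leftEnd d i j, j - 1) := by
    rw [hleft]; exact Prod.ext rfl (by simp only; omega)
  have hs2 : seg k₂ = (i + 1, rightEnd t d i j) := by
    rw [hright]; exact Prod.ext (by simp only; omega) rfl
  have hk12 : k₁ ≠ k₂ := by rintro rfl; omega
  have hsplit : (Finset.univ.val.map seg : Multisegment) =
      brokenPair t d i j + (({k₁, k₂} : Finset κ)ᶜ).val.map seg := by
    have h1 : (Finset.univ : Finset κ) = insert k₁ (insert k₂ {k₁, k₂}ᶜ) := by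
      ext k; simp only [Finset.mem_univ, Finset.mem_insert, Finset.mem_compl,
        Finset.mem_singleton, true_iff]; tauto
    rw [h1, Finset.insert_val_of_notMem (by simp [hk12]), Finset.insert_val_of_notMem (by simp),
      Multiset.map_cons, Multiset.map_cons, hs1, hs2, brokenPair]
    simp
  rw [hsplit, almostGeneric]
  congr 1
  refine Unlinked.eq_of_dim_eq ⟨?_, ?_⟩ (unlinked_generic _ _) fun l => ?_
  · intro s hs
    obtain ⟨k, -, rfl⟩ := Multiset.mem_map.1 hs
    exact hne k
  · intro s hs s' hs' hlink
    obtain ⟨k, hk, rfl⟩ := Multiset.mem_map.1 hs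
    obtain ⟨k', hk', rfl⟩ := Multiset.mem_map.1 hs'
    simp only [Finset.mem_val, Finset.mem_compl, Finset.mem_insert, Finset.mem_singleton,
      not_or] at hk hk'
    have h1 := hlink.1
    have h2 := hlink.2.1
    have h3 := hlink.2.2
    rcases g9 k k' (by omega) (by omega) (by omega) with h | h
    · exact hk.1 h
    · exact hk'.2 h
  · have h1 := dim_map Finset.univ seg l
    rw [hsplit, dim_add, hdim] at h1
    rw [dim_generic]
    split_ifs at h1 ⊢ <;> omega

/-! ### Orbits and their closures -/

section Orbit

variable {K : Type*} [Field K] {t : ℕ} {d : ℕ → ℕ}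

lemma Rep.rk_eq_of_mem_orbit {A B : Rep K t d} (h : B ∈ A.orbit) {i j : ℕ} (hi : 1 ≤ i)
    (hij : i ≤ j) (hj : j ≤ t) : B.rk i j = A.rk i j := by
  obtain ⟨g, hg⟩ := h
  have hi' : i ∈ Finset.Icc 1 t := Finset.mem_Icc.2 ⟨hi, hij.trans hj⟩
  have key : ∀ n (hn : i + n ∈ Finset.Icc 1 t),
      B.comp i n * (g ⟨i + n, hn⟩).1 = (g ⟨i, hi'⟩).1 * A.comp i n := by
    intro n
    induction n with
    | zero => intro hn; simp [Rep.comp]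
    | succ n ih =>
      intro hn
      have hl : i + n ∈ Finset.Ico 1 t := by
        simp only [Finset.mem_Ico, Finset.mem_Icc] at hn ⊢; omega
      have h1 : B.map (i + n) * (g ⟨i + (n + 1), hn⟩).1 =
          (g ⟨i + n, left_mem hl⟩).1 * A.map (i + n) := by
        rw [Rep.map, dif_pos hl, hg (i + n) hl, Rep.map, dif_pos hl, Matrix.mul_assoc]
        exact (congrArg (_ * ·) (Units.inv_mul _)).trans (Matrix.mul_one _)
      calc B.comp i (n + 1) * (g ⟨i + (n + 1), hn⟩).1
          = B.comp i n * (B.map (i + n) * (g ⟨i + (n + 1), hn⟩).1) := Matrix.mul_assoc _ _ _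
        _ = B.comp i n * (g ⟨i + n, left_mem hl⟩).1 * A.map (i + n) := by
          rw [h1, Matrix.mul_assoc]
        _ = (g ⟨i, hi'⟩).1 * (A.comp i n * A.map (i + n)) := by
          rw [ih (left_mem hl), Matrix.mul_assoc]
  have h1 := key (j - i) (Finset.mem_Icc.2 ⟨by omega, by omega⟩)
  have h2 := congrArg Matrix.rank h1
  rwa [Matrix.rank_mul_eq_left_of_isUnit_det _ _
      ((Matrix.isUnit_iff_isUnit_det _).1 (Units.isUnit _)),
    Matrix.rank_mul_eq_right_of_isUnit_det _ _
      ((Matrix.isUnit_iff_isUnit_det _).1 (Units.isUnit _))] at h2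

/-- Two points `g • A` and `g' • A` of an orbit are joined by the rational curve
`s ↦ ((1 - s) g + s g') • A`. -/
lemma isIrreducible_orbit [Infinite K] (A : Rep K t d) : IsIrreducible A.orbit := by
  classical
  refine ⟨⟨A, fun _ => 1, fun l hl => by simp⟩, isPreirreducible_of_rationalCurves ?_⟩
  rintro B ⟨g, hg⟩ B' ⟨g', hg'⟩
  let G : ∀ l : Finset.Icc 1 t, Matrix (Fin (d l)) (Fin (d l)) (Polynomial K) := fun l =>
    (g l).1.map Polynomial.C + (Polynomial.X : Polynomial K) • ((g' l).1 - (g l).1).map Polynomial.C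
  let Γ : K → ∀ l : Finset.Icc 1 t, Matrix (Fin (d l)) (Fin (d l)) K := fun s l =>
    (Polynomial.evalRingHom s).mapMatrix (G l)
  let q : Polynomial K := ∏ l, (G l).det
  let γ : K → Rep K t d := fun s l =>
    Γ s ⟨l, left_mem l.2⟩ * A l * (Γ s ⟨l + 1, right_mem l.2⟩)⁻¹
  have hΓ0 : ∀ l, Γ 0 l = g l := fun l => by ext a b; simp [Γ, G]
  have hΓ1 : ∀ l, Γ 1 l = g' l := fun l => by ext a b; simp [Γ, G]
  have hdet : ∀ s l, (Γ s l).det = (G l).det.eval s := fun s l =>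
    ((Polynomial.evalRingHom s).map_det (G l)).symm
  have hq : ∀ s, q.eval s = ∏ l, (Γ s l).det := fun s => by
    simp only [q, Polynomial.eval_prod, hdet]
  have hne : ∀ s, q.eval s ≠ 0 → ∀ l, (Γ s l).det ≠ 0 := fun s hs l => by
    rw [hq, Finset.prod_ne_zero_iff] at hs
    exact hs l (Finset.mem_univ l)
  have hunit (u : ∀ l : Finset.Icc 1 t, GL (Fin (d l)) K) (s : K) (hu : ∀ l, Γ s l = u l) :
      q.eval s ≠ 0 := by
    rw [hq, Finset.prod_ne_zero_iff]
    intro l _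
    rw [hu]
    exact ((Matrix.isUnit_iff_isUnit_det _).1 (Units.isUnit _)).ne_zero
  refine ⟨q, γ, ?_, ?_, ?_, hunit g 0 hΓ0, hunit g' 1 hΓ1, ?_⟩
  · intro l a b
    refine ⟨(∏ l' ∈ Finset.univ.erase ⟨l + 1, right_mem l.2⟩, (G l').det) *
      (G ⟨l, left_mem l.2⟩ * (A l).map Polynomial.C * (G ⟨l + 1, right_mem l.2⟩).adjugate) a b,
      fun s hs => ?_⟩
    have h1 : ((G ⟨l, left_mem l.2⟩ * (A l).map Polynomial.C *
        (G ⟨l + 1, right_mem l.2⟩).adjugate) a b).eval s =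
        (Γ s ⟨l, left_mem l.2⟩ * A l * (Γ s ⟨l + 1, right_mem l.2⟩).adjugate) a b := by
      have hA : ((A l).map Polynomial.C).map (Polynomial.evalRingHom s) = A l := by
        ext x y; simp
      have h2 : (G ⟨l + 1, right_mem l.2⟩).adjugate.map (Polynomial.evalRingHom s) =
          (Γ s ⟨l + 1, right_mem l.2⟩).adjugate :=
        (Polynomial.evalRingHom s).map_adjugate (G ⟨l + 1, right_mem l.2⟩)
      have h3 : (G ⟨l, left_mem l.2⟩ * (A l).map Polynomial.C *
        (G ⟨l + 1, right_mem l.2⟩).adjugate).map (Polynomial.evalRingHom s) =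
        Γ s ⟨l, left_mem l.2⟩ * A l * (Γ s ⟨l + 1, right_mem l.2⟩).adjugate := by
        rw [Matrix.map_mul, Matrix.map_mul, hA, h2]; rfl
      exact congrFun (congrFun h3 a) b
    rw [Polynomial.eval_mul, h1, hq, ← Finset.mul_prod_erase Finset.univ _
      (Finset.mem_univ (⟨l + 1, right_mem l.2⟩ : Finset.Icc 1 t)), Polynomial.eval_prod]
    simp only [γ, ← hdet, Matrix.inv_def, Ring.inverse_eq_inv', Matrix.mul_smul, Matrix.smul_apply,
      smul_eq_mul]
    have := hne s hs ⟨l + 1, right_mem l.2⟩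
    field_simp
  · funext l
    rw [hg l.1 l.2, Matrix.coe_units_inv, ← hΓ0, ← hΓ0]
  · funext l
    rw [hg' l.1 l.2, Matrix.coe_units_inv, ← hΓ1, ← hΓ1]
  · intro s hs
    refine ⟨fun l => Matrix.GeneralLinearGroup.mkOfDetNeZero (Γ s l) (hne s hs l), fun l hl => ?_⟩
    rw [Matrix.coe_units_inv]
    rfl

end Orbit

section Locus

variable {K : Type*} [Field K] {t : ℕ} {d : ℕ → ℕ} {i j : ℕ}

lemma maxRank_eq (hij : (i, j) ∈ J t d) : maxRank d i j = min (d i) (d j) := by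
  obtain ⟨-, h1, -, h2⟩ := hij
  simp only at h1 h2
  refine le_antisymm (le_min (Nat.sInf_le ⟨i, ⟨le_rfl, h1.le⟩, rfl⟩)
    (Nat.sInf_le ⟨j, ⟨h1.le, le_rfl⟩, rfl⟩)) (le_csInf ⟨_, i, ⟨le_rfl, h1.le⟩, rfl⟩ ?_)
  rintro _ ⟨l, ⟨h3, h4⟩, rfl⟩
  rcases eq_or_lt_of_le h3 with rfl | h3
  · exact min_le_left _ _
  rcases eq_or_lt_of_le h4 with rfl | h4
  · exact min_le_right _ _
  · have := h2 l h3 h4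
    omega

lemma degeneracyLocus_eq (hij : (i, j) ∈ J t d) :
    degeneracyLocus K t d i j = {A | A.rk i j < min (d i) (d j)} := by
  ext A
  rw [← maxRank_eq hij]
  change (A.rk i j : ℤ) ≤ (maxRank d i j : ℤ) - 1 ↔ A.rk i j < maxRank d i j
  omega

lemma isClosed_degeneracyLocus (hij : (i, j) ∈ J t d) :
    IsClosed (degeneracyLocus K t d i j) := by
  rw [degeneracyLocus_eq hij]
  exact isClosed_rank_lt (.comp i (j - i)) _

lemma IsFrame.rk_eq {A : Rep K t d} {ι : Type} [Fintype ι] {seg : ι → ℕ × ℕ}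
    {v : ι → ∀ l, Fin (d l) → K} (hv : IsFrame A (whole K t d) seg v) (hij : (i, j) ∈ J t d) :
    A.rk i j = (Finset.univ.filter fun k => (seg k).1 ≤ i ∧ j ≤ (seg k).2).card := by
  obtain ⟨h1, h2, h3, -⟩ := hij
  simp only at h1 h2 h3
  have h : i + (j - i) = j := by omega
  rw [Rep.rk, hv.rank_comp (by rw [h, Finset.mem_Icc]; omega), h]

/-- As long as the rank condition allows it, linked summands are exchanged. This makes the sum of
the squares of their lengths larger and ends with the multisegment `almostGeneric`. -/
theorem mem_closure_almostGeneric [Infinite K] (hij : (i, j) ∈ J t d) (hi : 0 < d i)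
    (hj : 0 < d j) {A : Rep K t d} (hA : A.rk i j < min (d i) (d j)) :
    A ∈ closure {B : Rep K t d | HasSummands B (almostGeneric t d i j) ∧
      B.rk i j < min (d i) (d j)} := by
  classical
  obtain ⟨ι, _, seg, v, hv⟩ := exists_isFrame A
  induction hN : Fintype.card ι * t ^ 2 - ∑ k, ((seg k).2 + 1 - (seg k).1) ^ 2
    using Nat.strong_induction_on generalizing A seg v with | _ N ih
  by_cases hex : ∃ k k', Linked (seg k) (seg k') ∧
      (Finset.univ.filter fun x =>
        (exchange seg k k' x).1 ≤ i ∧ j ≤ (exchange seg k k' x).2).card < min (d i) (d j)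
  · obtain ⟨k, k', hlink, hlt⟩ := hex
    obtain ⟨γ, hγ, rfl, hframe⟩ := hv.exists_deformation hlink
    rw [← closure_closure]
    refine hγ.zero_mem_closure fun s hs => ?_
    obtain ⟨v', hv'⟩ := hframe s hs
    refine ih _ ?_ (by rwa [hv'.rk_eq hij]) _ v' hv' rfl
    have hsum := sum_sq_lt_exchange hlink
    have hbound : ∑ x, ((exchange seg k k' x).2 + 1 - (exchange seg k k' x).1) ^ 2 ≤
        Fintype.card ι * t ^ 2 := by
      rw [← smul_eq_mul, ← Finset.card_univ]
      refine Finset.sum_le_card_nsmul _ _ _ fun x _ => Nat.pow_le_pow_left ?_ 2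
      by_cases hx : (exchange seg k k' x).1 ≤ (exchange seg k k' x).2
      · have h1 := hv'.mem_Icc le_rfl hx
        have h2 := hv'.mem_Icc hx le_rfl
        simp only [Finset.mem_Icc] at h1 h2
        omega
      · omega
    omega
  · refine subset_closure ⟨⟨_, inferInstance, _, _, hv.nonempty, ?_⟩, hA⟩
    have hrk := hv.rk_eq hij
    have hrk' := hv.nonempty.rk_eq hij
    refine map_eq_almostGeneric hij hi hj (fun k => k.2) hv.nonempty.card_whole
      (by rwa [← hrk']) fun k k' hlink => ?_
    have h1 := card_exchange_rank (k₁ := k.1) (k₂ := k'.1) hlink i j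
    have h2 : ¬ _ := fun h => hex ⟨k, k', hlink, h⟩
    rw [← hrk']
    rw [h1, ← hrk] at h2
    split_ifs at h2 with h3
    · exact ⟨by omega, h3⟩
    · omega

theorem exists_closure_orbit [Infinite K] (hij : (i, j) ∈ J t d) (hi : 0 < d i)
    (hj : 0 < d j) : ∃ A : Rep K t d, HasSummands A (almostGeneric t d i j) ∧
      degeneracyLocus K t d i j = closure A.orbit := by
  have hij' := hij
  obtain ⟨h1, h2, h3, -⟩ := hij'
  simp only at h1 h2 h3
  let Z : Rep K t d := fun _ => 0
  have h0 : Z.rk i j < min (d i) (d j) := by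
    have hZ : ∀ l, Z.map l = 0 := fun l => by unfold Rep.map; split_ifs <;> rfl
    have : Z.comp i (j - i) = 0 := by
      obtain ⟨n, hn⟩ := Nat.exists_eq_succ_of_ne_zero (show j - i ≠ 0 by omega)
      rw [hn, Rep.comp, hZ, Matrix.mul_zero]
    rw [Rep.rk, this, Matrix.rank_zero]
    exact lt_min hi hj
  obtain ⟨A, hA, hAr⟩ := closure_nonempty_iff.1 ⟨_, mem_closure_almostGeneric hij hi hj h0⟩
  refine ⟨A, hA, subset_antisymm ?_ ?_⟩
  · intro B hB
    rw [degeneracyLocus_eq hij] at hB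
    exact closure_mono (fun C hC => hA.mem_orbit hC.1) (mem_closure_almostGeneric hij hi hj hB)
  · refine closure_minimal (fun B hB => ?_) (isClosed_degeneracyLocus hij)
    rw [degeneracyLocus_eq hij]
    change B.rk i j < _
    rwa [Rep.rk_eq_of_mem_orbit hB h1 h2.le h3]

lemma isIrreducible_degeneracyLocus [Infinite K] (hij : (i, j) ∈ J t d) (hi : 0 < d i)
    (hj : 0 < d j) : IsIrreducible (degeneracyLocus K t d i j) := by
  obtain ⟨A, -, h⟩ := exists_closure_orbit (K := K) hij hi hj
  rw [h]
  exact (isIrreducible_orbit A).closure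

end Locus

/-! ### Upper bound for the codimension -/

section MatrixRank

variable {K : Type*} [Field K]

lemma rank_lt_of_row_eq_zero {r n : ℕ} {M : Matrix (Fin r) (Fin n) K} (a : Fin r)
    (h : ∀ b, M a b = 0) : M.rank < r := by
  by_contra hr
  obtain ⟨P, Q, hdet⟩ := (le_rank_iff_exists_det M r).1 (not_lt.1 hr)
  rw [Matrix.mul_assoc, Matrix.det_mul] at hdet
  refine hdet (mul_eq_zero_of_right _ (Matrix.det_eq_zero_of_row_eq_zero a fun b => ?_))
  simp [Matrix.mul_apply, h]

/-- If the columns `e` of a matrix with `r + 1` rows are linearly independent, then the maximal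
minors on these columns and one further column decide whether the rank is smaller than `r + 1`. -/
lemma rank_lt_of_minors {r n : ℕ} {M : Matrix (Fin (r + 1)) (Fin n) K} {e : Fin r → Fin n}
    (he : r ≤ (M.submatrix id e).rank)
    (h : ∀ k, k ∉ Set.range e →
      (M.submatrix id (Fin.cons k e : Fin (r + 1) → Fin n)).det = 0) : M.rank < r + 1 := by
  have hli : LinearIndependent K fun x => M.col (e x) := by
    rw [linearIndependent_iff_card_eq_finrank_span, Fintype.card_fin]
    refine le_antisymm ?_ ((finrank_range_le_card _).trans (Fintype.card_fin r).le)
    rwa [Matrix.rank_eq_finrank_span_cols] at he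
  have hmem : ∀ k, M.col k ∈ Submodule.span K (Set.range fun x => M.col (e x)) := by
    intro k
    by_cases hk : k ∈ Set.range e
    · obtain ⟨x, rfl⟩ := hk
      exact Submodule.subset_span ⟨x, rfl⟩
    · by_contra hnot
      have hcons := linearIndependent_finCons.2 ⟨hli, hnot⟩
      have hcol : (M.submatrix id (Fin.cons k e : Fin (r + 1) → Fin n)).col =
          (Fin.cons (M.col k) fun x => M.col (e x) : Fin (r + 1) → Fin (r + 1) → K) := by
        funext x
        refine Fin.cases ?_ (fun x => ?_) x <;> rfl
      rw [← hcol, Matrix.linearIndependent_cols_iff_isUnit, Matrix.isUnit_iff_isUnit_det,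
        h k hk] at hcons
      exact not_isUnit_zero hcons
  rw [Matrix.rank_eq_finrank_span_cols, Nat.lt_succ_iff]
  calc Module.finrank K (Submodule.span K (Set.range M.col))
      ≤ Module.finrank K (Submodule.span K (Set.range fun x => M.col (e x))) :=
        Submodule.finrank_mono (Submodule.span_le.2 (by rintro _ ⟨k, rfl⟩; exact hmem k))
    _ ≤ r := (finrank_range_le_card _).trans (Fintype.card_fin r).le

lemma le_rank_of_mul_eq_one {m n : Type*} [Fintype m] [Fintype n] [DecidableEq m]
    {M : Matrix m n K} {N : Matrix n m K} (h : M * N = 1) : Fintype.card m ≤ M.rank := by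
  rw [← Matrix.rank_one (R := K) (n := m), ← h]
  exact Matrix.rank_mul_le_left M N

end MatrixRank

section Height

variable {K : Type*} [Field K] {t : ℕ} {d : ℕ → ℕ}

/-- The ideal of all polynomials that vanish on `Z`. -/
def vanishing (Z : Set (Rep K t d)) : Ideal (MvPolynomial (Entry t d) K) :=
  MvPolynomial.vanishingIdeal K (Rep.coords '' Z)

lemma mem_vanishing {Z : Set (Rep K t d)} {f : MvPolynomial (Entry t d) K} :
    f ∈ vanishing Z ↔ ∀ A ∈ Z, MvPolynomial.eval A.coords f = 0 := by
  rw [vanishing, MvPolynomial.mem_vanishingIdeal_iff, Set.forall_mem_image]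
  rfl

lemma isPrime_vanishing {Z : Set (Rep K t d)} (hZ : IsIrreducible Z) : (vanishing Z).IsPrime := by
  refine ⟨fun h => ?_, fun {f g} hfg => ?_⟩
  · obtain ⟨A, hA⟩ := hZ.1
    have : (1 : MvPolynomial (Entry t d) K) ∈ vanishing Z := h ▸ Submodule.mem_top
    simpa using mem_vanishing.1 this A hA
  · simp only [mem_vanishing] at hfg ⊢
    refine isPreirreducible_iff_isClosed_union_isClosed.1 hZ.2 _ _
      (isClosed_zero (mem_regular.2 ⟨f, fun _ => rfl⟩))
      (isClosed_zero (mem_regular.2 ⟨g, fun _ => rfl⟩)) fun A hA => ?_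
    have := hfg A hA
    rwa [map_mul, mul_eq_zero] at this

lemma mem_of_isClosed_of_vanishing {Z : Set (Rep K t d)} (hZ : IsClosed Z) {A : Rep K t d}
    (h : ∀ f ∈ vanishing Z, MvPolynomial.eval A.coords f = 0) : A ∈ Z := by
  obtain ⟨S, rfl⟩ := isClosed_iff_zeros.1 hZ
  exact fun f hf => h f (mem_vanishing.2 fun B hB => hB f hf)

/-- The codimension of an irreducible closed set is at most the height of its ideal. -/
lemma coheight_le_height (W : TopologicalSpace.IrreducibleCloseds (Rep K t d)) :
    Order.coheight W ≤ (vanishing (W : Set (Rep K t d))).height := by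
  let f : TopologicalSpace.IrreducibleCloseds (Rep K t d) →
      (PrimeSpectrum (MvPolynomial (Entry t d) K))ᵒᵈ := fun W =>
    OrderDual.toDual ⟨vanishing (W : Set (Rep K t d)), isPrime_vanishing W.isIrreducible'⟩
  have hf : StrictMono f := by
    intro W W' hlt
    have hle : (W : Set (Rep K t d)) ⊆ W' := hlt.le
    refine lt_of_le_not_ge (α := (PrimeSpectrum (MvPolynomial (Entry t d) K))ᵒᵈ)
      (fun g (hg : g ∈ vanishing _) => mem_vanishing.2 fun A hA => mem_vanishing.1 hg A (hle hA))
      fun hge => hlt.not_ge fun A hA => ?_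
    exact mem_of_isClosed_of_vanishing W.isClosed' fun g hg => mem_vanishing.1 (hge hg) A hA
  refine (Order.coheight_le_coheight_apply_of_strictMono f hf W).trans ?_
  rw [PrimeSpectrum.height_eq_orderHeight
    ⟨vanishing (W : Set (Rep K t d)), isPrime_vanishing W.isIrreducible'⟩]
  exact le_rfl

/-- An irreducible locus of matrices with `r` rows, `n ≥ r` columns and rank smaller than `r` has
codimension at most `n - r + 1` as soon as the rank `r - 1` occurs: near a point where the columns
`e` are independent it is cut out by `n - r + 1` minors, so Krull's height theorem applies. -/
theorem coheight_le_of_rank_lt [IsAlgClosed K] {r n : ℕ}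
    {F : Rep K t d → Matrix (Fin (r + 1)) (Fin n) K} (hF : RegularMatrix F)
    (W : TopologicalSpace.IrreducibleCloseds (Rep K t d))
    (hW : ∀ A, A ∈ W ↔ (F A).rank < r + 1) {A₀ : Rep K t d} (hA₀ : A₀ ∈ W)
    {e : Fin r → Fin n} (he : Function.Injective e) (hr : r ≤ ((F A₀).submatrix id e).rank) :
    Order.coheight W ≤ (n - r : ℕ) := by
  classical
  have hprime := isPrime_vanishing W.isIrreducible'
  have hsub {q : ℕ} (c : Fin q → Fin n) : RegularMatrix fun A => (F A).submatrix id c :=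
    fun a b => hF a (c b)
  have hminor (k : Fin n) := mem_regular.1 (hsub (Fin.cons k e : Fin (r + 1) → Fin n)).det
  choose f hf using hminor
  let s : Finset (MvPolynomial (Entry t d) K) := (Finset.univ \ Finset.univ.image e).image f
  have hs : s.card ≤ n - r := by
    refine Finset.card_image_le.trans ?_
    rw [Finset.card_sdiff_of_subset (Finset.subset_univ _), Finset.card_image_of_injective _ he]
    simp
  refine (coheight_le_height W).trans ((Ideal.height_le_card_of_mem_minimalPrimes_span_finset
    (s := s) ⟨⟨hprime, ?_⟩, ?_⟩).trans (by exact_mod_cast hs))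
  · rw [Ideal.span_le]
    intro g hg
    obtain ⟨k, -, rfl⟩ := Finset.mem_image.1 hg
    refine mem_vanishing.2 fun A hA => ?_
    rw [hf]
    by_contra hdet
    have h1 : ((F A).submatrix id (Fin.cons k e : Fin (r + 1) → Fin n)).rank = r + 1 := by
      rw [Matrix.rank_of_isUnit _ ((Matrix.isUnit_iff_isUnit_det _).2 (Ne.isUnit hdet))]; simp
    have h2 := (F A).rank_submatrix_le id (Fin.cons k e : Fin (r + 1) → Fin n)
    have h3 := (hW A).1 hA
    omega
  · rintro P ⟨hP, hsP⟩ hPW g hg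
    -- a polynomial that vanishes wherever the columns `e` are dependent, but not at `A₀`
    obtain ⟨δ, hδ, hδ0, hδe⟩ := exists_regular_of_isOpen
      (isClosed_rank_lt (hsub e) r).isOpen_compl (A := A₀) (not_lt.2 hr)
    obtain ⟨δ, hδ⟩ := mem_regular.1 hδ
    have hmul : δ * g ∈ MvPolynomial.vanishingIdeal K (MvPolynomial.zeroLocus K P) := by
      rw [MvPolynomial.mem_vanishingIdeal_iff]
      intro x hx
      let A : Rep K t d := fun l a b => x ⟨l, a, b⟩
      have hAx : A.coords = x := rfl
      rw [MvPolynomial.mem_zeroLocus_iff] at hx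
      rw [map_mul]
      by_cases hδx : MvPolynomial.aeval x δ = 0
      · rw [hδx, zero_mul]
      · have hA : A ∈ W := by
          rw [hW]
          refine rank_lt_of_minors (e := e) (not_lt.1 (hδe A ?_)) fun k hk => ?_
          · rw [← hδ]; exact hδx
          · rw [← hf, hAx]
            refine hx _ (hsP (Ideal.subset_span (Finset.mem_image_of_mem f ?_)))
            simpa using hk
        have := mem_vanishing.1 hg A hA
        exact mul_eq_zero_of_right _ this
    rw [MvPolynomial.vanishingIdeal_zeroLocus_eq_radical, hP.radical] at hmul
    refine (hP.mem_or_mem hmul).resolve_left fun h => hδ0 ?_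
    rw [← hδ]
    exact mem_vanishing.1 (hPW h) A₀ hA₀

end Height

/-! ### Restriction to smaller matrices -/

section Restriction

variable {K : Type*} {t : ℕ} {d d' : ℕ → ℕ}

/-- The restriction of all matrices to their upper left parts of smaller sizes. -/
def Rep.restrict (h : ∀ l, d' l ≤ d l) (A : Rep K t d) : Rep K t d' :=
  fun l => (A l).submatrix (Fin.castLE (h l)) (Fin.castLE (h (l + 1)))

/-- The representation whose restriction is `B`, with the remaining entries taken from `C`. -/
def Rep.extend (B : Rep K t d') (C : Rep K t d) : Rep K t d := fun l a b =>
  if h : (a : ℕ) < d' l ∧ (b : ℕ) < d' (l + 1) then B l ⟨a, h.1⟩ ⟨b, h.2⟩ else C l a b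

lemma Rep.restrict_extend (h : ∀ l, d' l ≤ d l) (B : Rep K t d') (C : Rep K t d) :
    (Rep.extend B C).restrict h = B := by
  funext l; ext a b; simp [Rep.restrict, Rep.extend]

lemma Rep.extend_restrict (h : ∀ l, d' l ≤ d l) (A : Rep K t d) :
    Rep.extend (A.restrict h) A = A := by
  funext l; ext a b
  simp only [Rep.extend, Rep.restrict]
  split_ifs <;> rfl

variable [Field K]

lemma Rep.continuous_restrict (h : ∀ l, d' l ≤ d l) :
    Continuous (Rep.restrict h : Rep K t d → Rep K t d') :=
  continuous_of_regular fun l _ _ => regular_entry l _ _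

lemma Rep.isIrreducible_preimage_restrict [Infinite K] (h : ∀ l, d' l ≤ d l)
    {Z : Set (Rep K t d')} (hZ : IsIrreducible Z) : IsIrreducible (Rep.restrict h ⁻¹' Z) := by
  have : Rep.restrict h ⁻¹' Z = Set.image2 Rep.extend Z (Set.univ : Set (Rep K t d)) := by
    ext A
    constructor
    · intro hA
      exact ⟨_, hA, A, trivial, Rep.extend_restrict h A⟩
    · rintro ⟨B, hB, C, -, rfl⟩
      rwa [Set.mem_preimage, Rep.restrict_extend]
  rw [this]
  refine isIrreducible_image2_of_separatelyContinuous hZ (isIrreducible_univ_rep K t d)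
    (fun C => continuous_of_regular fun l a b => ?_)
    (fun B => continuous_of_regular fun l a b => ?_)
  · by_cases hab : (a : ℕ) < d' l ∧ (b : ℕ) < d' (l + 1)
    · simpa only [Rep.extend, dif_pos hab] using regular_entry l _ _
    · simpa only [Rep.extend, dif_neg hab] using regular_const _
  · by_cases hab : (a : ℕ) < d' l ∧ (b : ℕ) < d' (l + 1)
    · simpa only [Rep.extend, dif_pos hab] using regular_const _
    · simpa only [Rep.extend, dif_neg hab] using regular_entry l _ _

/-- Inverse images under a restriction embed the irreducible closed sets. -/
def Rep.preimageRestrict [Infinite K] (h : ∀ l, d' l ≤ d l)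
    (W : TopologicalSpace.IrreducibleCloseds (Rep K t d')) :
    TopologicalSpace.IrreducibleCloseds (Rep K t d) :=
  ⟨Rep.restrict h ⁻¹' W, Rep.isIrreducible_preimage_restrict h W.isIrreducible',
    W.isClosed'.preimage (Rep.continuous_restrict h)⟩

lemma Rep.mem_preimageRestrict [Infinite K] {h : ∀ l, d' l ≤ d l}
    {W : TopologicalSpace.IrreducibleCloseds (Rep K t d')} {A : Rep K t d} :
    A ∈ Rep.preimageRestrict h W ↔ A.restrict h ∈ W := Iff.rfl

lemma Rep.coheight_le_preimageRestrict [Infinite K] (h : ∀ l, d' l ≤ d l)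
    (W : TopologicalSpace.IrreducibleCloseds (Rep K t d')) :
    Order.coheight W ≤ Order.coheight (Rep.preimageRestrict (d := d) h W) := by
  refine Order.coheight_le_coheight_apply_of_strictMono _ (fun W W' hlt => ?_) W
  refine lt_of_le_not_ge (fun A hA => hlt.le hA) fun hge => hlt.not_ge fun B hB => ?_
  let Z : Rep K t d := fun _ => 0
  have : Rep.extend B Z ∈ Rep.preimageRestrict h W :=
    hge (by rwa [Rep.mem_preimageRestrict, Rep.restrict_extend])
  rwa [Rep.mem_preimageRestrict, Rep.restrict_extend] at this

lemma Rep.map_restrict (h : ∀ l, d' l ≤ d l) (A : Rep K t d) (l : ℕ) :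
    (A.restrict h).map l = (A.map l).submatrix (Fin.castLE (h l)) (Fin.castLE (h (l + 1))) := by
  unfold Rep.map
  split_ifs <;> rfl

lemma Rep.comp_succ (A : Rep K t d) (i n : ℕ) :
    A.comp i (n + 1) = A.comp i n * A.map (i + n) := rfl

lemma Rep.comp_restrict (h : ∀ l, d' l ≤ d l) (A : Rep K t d) (i n : ℕ)
    (hd : ∀ l, i < l → l < i + (n + 1) → d' l = d l) :
    (A.restrict h).comp i (n + 1) =
      (A.comp i (n + 1)).submatrix (Fin.castLE (h i)) (Fin.castLE (h (i + (n + 1)))) := by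
  induction n with
  | zero => simp only [Rep.comp, Matrix.one_mul]; exact A.map_restrict h i
  | succ n ih =>
    rw [Rep.comp_succ, ih (fun l h1 h2 => hd l h1 (by omega)), Rep.map_restrict]
    have heq : d' (i + (n + 1)) = d (i + (n + 1)) := hd _ (by omega) (by omega)
    ext a b
    rw [Matrix.submatrix_apply, A.comp_succ i (n + 1), Matrix.mul_apply, Matrix.mul_apply]
    exact Fintype.sum_equiv (finCongr heq) _ _ fun c => rfl

/-- Every matrix is the product of the matrices of some representation if the spaces in between are
large enough. -/
lemma Rep.exists_comp_eq {i n : ℕ} (hi : 1 ≤ i) (hn : i + (n + 1) ≤ t)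
    (hd : ∀ l, i ≤ l → l < i + (n + 1) → d i ≤ d l)
    (C : Matrix (Fin (d i)) (Fin (d (i + (n + 1)))) K) :
    ∃ A : Rep K t d, A.comp i (n + 1) = C := by
  let A : Rep K t d := fun l a b =>
    if h : (l : ℕ) = i + n then
      if ha : (a : ℕ) < d i then C ⟨a, ha⟩ (Fin.cast (by rw [h]; rfl) b) else 0
    else if (a : ℕ) = b then 1 else 0
  have hmap : ∀ l, l ∈ Finset.Ico 1 t → ∀ a b, A.map l a b = if h : l = i + n then
      if ha : (a : ℕ) < d i then C ⟨a, ha⟩ (Fin.cast (by rw [h]; rfl) b) else 0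
      else if (a : ℕ) = b then 1 else 0 := fun l hl a b => by
    rw [Rep.map, dif_pos hl]
  have hcomp : ∀ k, k ≤ n → ∀ a b, A.comp i k a b = if (a : ℕ) = b then 1 else 0 := by
    intro k hk
    induction k with
    | zero => intro a b; simp [Rep.comp, Matrix.one_apply, Fin.ext_iff]
    | succ k ih =>
      intro a b
      have ha : (a : ℕ) < d (i + k) := a.2.trans_le (hd _ (by omega) (by omega))
      rw [Rep.comp, Matrix.mul_apply, Finset.sum_eq_single ⟨a, ha⟩]
      · rw [ih (by omega), hmap _ (by simp; omega), dif_neg (by omega)]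
        simp
      · intro c _ hc
        rw [ih (by omega), if_neg (fun h => hc (Fin.ext h.symm)), zero_mul]
      · simp
  refine ⟨A, ?_⟩
  ext a b
  have ha : (a : ℕ) < d (i + n) := a.2.trans_le (hd _ (by omega) (by omega))
  rw [Rep.comp, Matrix.mul_apply, Finset.sum_eq_single ⟨a, ha⟩]
  · rw [hcomp n le_rfl, hmap _ (by simp; omega), dif_pos rfl]
    simp
  · intro c _ hc
    rw [hcomp n le_rfl, if_neg (fun h => hc (Fin.ext h.symm)), zero_mul]
  · simp

lemma Rep.rk_add (A : Rep K t d) (i n : ℕ) : A.rk i (i + n) = (A.comp i n).rank := by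
  rw [Rep.rk, Nat.add_sub_cancel_left]

end Restriction

/-! ### Lower bound for the codimension and conclusion -/

section Codimension

variable {K : Type*} [Field K] {t : ℕ} {d d' : ℕ → ℕ} {i n : ℕ}

/-- The degeneracy locus as an irreducible closed set. -/
def irreducibleLocus [Infinite K] {j : ℕ} (hij : (i, j) ∈ J t d) (hi : 0 < d i) (hj : 0 < d j) :
    TopologicalSpace.IrreducibleCloseds (Rep K t d) :=
  ⟨degeneracyLocus K t d i j, isIrreducible_degeneracyLocus hij hi hj,
    isClosed_degeneracyLocus hij⟩

lemma mem_irreducibleLocus [Infinite K] (hij : (i, i + (n + 1)) ∈ J t d) (hi : 0 < d i)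
    (hj : 0 < d (i + (n + 1))) {A : Rep K t d} : A ∈ irreducibleLocus hij hi hj ↔
      (A.comp i (n + 1)).rank < min (d i) (d (i + (n + 1))) := by
  rw [← Rep.rk_add]
  change A ∈ degeneracyLocus K t d i (i + (n + 1)) ↔ _
  rw [degeneracyLocus_eq hij]; rfl

lemma exists_comp_eq_of_mem_J (hij : (i, i + (n + 1)) ∈ J t d)
    (C : Matrix (Fin (d i)) (Fin (d (i + (n + 1)))) K) :
    ∃ A : Rep K t d, A.comp i (n + 1) = C := by
  obtain ⟨h1, h2, h3, h4⟩ := hij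
  simp only at h1 h2 h3 h4
  refine Rep.exists_comp_eq h1 h3 (fun l h5 h6 => ?_) C
  rcases eq_or_lt_of_le h5 with rfl | h5
  · exact le_rfl
  · have := h4 l h5 h6; omega

/-- Making one of the two end spaces smaller gives a larger locus; the matrix `C` shows that it is
strictly larger. -/
lemma coheight_irreducibleLocus_add_one_le [Infinite K] (h : ∀ l, d' l ≤ d l)
    (hd : ∀ l, i < l → l < i + (n + 1) → d' l = d l) (hij : (i, i + (n + 1)) ∈ J t d)
    (hij' : (i, i + (n + 1)) ∈ J t d') (hi : 0 < d' i) (hj : 0 < d' (i + (n + 1)))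
    (hmin : min (d' i) (d' (i + (n + 1))) = min (d i) (d (i + (n + 1))))
    (C : Matrix (Fin (d i)) (Fin (d (i + (n + 1)))) K)
    (hC : min (d i) (d (i + (n + 1))) ≤ C.rank)
    (hC' : (C.submatrix (Fin.castLE (h i)) (Fin.castLE (h (i + (n + 1))))).rank <
      min (d i) (d (i + (n + 1)))) :
    Order.coheight (irreducibleLocus (K := K) hij' hi hj) + 1 ≤
      Order.coheight (irreducibleLocus (K := K) hij (hi.trans_le (h _)) (hj.trans_le (h _))) := by
  have hlt : irreducibleLocus (K := K) hij (hi.trans_le (h _)) (hj.trans_le (h _)) <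
      Rep.preimageRestrict h (irreducibleLocus (K := K) hij' hi hj) := by
    refine lt_of_le_not_ge (fun A hA => ?_) fun hge => ?_
    · rw [mem_irreducibleLocus] at hA
      rw [Rep.mem_preimageRestrict, mem_irreducibleLocus, Rep.comp_restrict h A i n hd, hmin]
      exact (Matrix.rank_submatrix_le _ _ _).trans_lt hA
    · obtain ⟨A, hA⟩ := exists_comp_eq_of_mem_J hij C
      have h1 : A ∈ Rep.preimageRestrict h (irreducibleLocus (K := K) hij' hi hj) := by
        rwa [Rep.mem_preimageRestrict, mem_irreducibleLocus, Rep.comp_restrict h A i n hd, hmin, hA]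
      have h2 := hge h1
      rw [mem_irreducibleLocus, hA] at h2
      exact h2.not_ge hC
  exact (add_le_add_left (Rep.coheight_le_preimageRestrict h _) 1).trans
    (Order.coheight_add_one_le hlt)

lemma codim_eq_coheight {X : Type*} [TopologicalSpace X]
    (W : TopologicalSpace.IrreducibleCloseds X) : codim (W : Set X) = Order.coheight W :=
  le_antisymm (iInf_le_of_le ⟨W, subset_rfl⟩ le_rfl) (le_iInf fun V => Order.coheight_anti V.2)

variable (K) in
/-- The matrix with an identity block in the columns `k, …, k + r - 1` and zeros elsewhere. -/
def idBlock (r n k : ℕ) : Matrix (Fin r) (Fin n) K := fun a b => if (b : ℕ) = a + k then 1 else 0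

lemma le_rank_idBlock {r n k : ℕ} (h : r + k ≤ n) : r ≤ (idBlock K r n k).rank := by
  have : idBlock K r n k * (idBlock K r n k).transpose = 1 := by
    ext a a'
    rw [Matrix.mul_apply, Finset.sum_eq_single ⟨a + k, by omega⟩]
    · simp [idBlock, Matrix.one_apply, Fin.ext_iff]
    · intro b _ hb
      have : (b : ℕ) ≠ a + k := fun h => hb (Fin.ext h)
      simp [idBlock, this]
    · simp
  simpa using le_rank_of_mul_eq_one this

/-- Lowering the larger one of the two numbers `d i`, `d j` step by step until they agree gives a
chain of irreducible closed sets above the degeneracy locus. -/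
theorem le_coheight_irreducibleLocus [Infinite K] (hij : (i, i + (n + 1)) ∈ J t d) (hi : 0 < d i)
    (hj : 0 < d (i + (n + 1))) :
    ((((d (i + (n + 1)) : ℤ) - d i).natAbs + 1 : ℕ) : ℕ∞) ≤
      Order.coheight (irreducibleLocus (K := K) hij hi hj) := by
  induction hN : ((d (i + (n + 1)) : ℤ) - d i).natAbs generalizing d with
  | zero =>
    let V : TopologicalSpace.IrreducibleCloseds (Rep K t d) :=
      ⟨Set.univ, isIrreducible_univ_rep K t d, isClosed_univ⟩
    obtain ⟨A, hA⟩ := exists_comp_eq_of_mem_J hij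
      (idBlock K (d i) (d (i + (n + 1))) 0)
    have hlt : irreducibleLocus (K := K) hij hi hj < V := by
      refine lt_of_le_not_ge (fun _ _ => trivial) fun hge => ?_
      have h := hge (show A ∈ V from trivial)
      rw [mem_irreducibleLocus, hA] at h
      have := le_rank_idBlock (K := K) (r := d i) (n := d (i + (n + 1))) (k := 0) (by omega)
      omega
    refine le_trans ?_ (Order.coheight_add_one_le hlt)
    simp
  | succ N ih =>
    have hJ := hij
    obtain ⟨h1, h2, h3, h4⟩ := hJ
    simp only at h1 h2 h3 h4
    rcases lt_or_ge (d i) (d (i + (n + 1))) with hlt | hge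
    · let d' := Function.update d (i + (n + 1)) (d (i + (n + 1)) - 1)
      have e1 : d' (i + (n + 1)) = d (i + (n + 1)) - 1 := by simp [d']
      have e2 : ∀ l, l ≠ i + (n + 1) → d' l = d l := fun l hl => by simp [d', hl]
      have e3 : d' i = d i := e2 i (by omega)
      have hle : ∀ l, d' l ≤ d l := fun l => by
        by_cases hl : l = i + (n + 1)
        · rw [hl, e1]; omega
        · rw [e2 l hl]
      have hij' : (i, i + (n + 1)) ∈ J t d' := ⟨h1, h2, h3, fun l h5 h6 => by
        have := h4 l h5 h6
        simp only at h5 h6 ⊢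
        rw [e1, e3, e2 l (by omega)]; omega⟩
      have hmin : min (d i) (d (i + (n + 1))) = d i := by omega
      have hind := ih hij' (by omega) (by omega) (by rw [e1, e3]; omega)
      have hstep := coheight_irreducibleLocus_add_one_le (K := K) hle
        (fun l h5 h6 => e2 l (by omega)) hij hij' (by omega) (by omega)
        (by rw [e1, e3]; omega)
        (idBlock K (d i) (d (i + (n + 1))) (d (i + (n + 1)) - d i))
        (by rw [hmin]; exact le_rank_idBlock (by omega))
        (by
          rw [hmin]
          refine (rank_lt_of_row_eq_zero ⟨d i - 1, by omega⟩ fun b => ?_).trans_eq e3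
          have hb := b.2
          simp only [Matrix.submatrix_apply, idBlock, Fin.val_castLE]
          rw [if_neg (by omega)])
      refine le_trans ?_ hstep
      push_cast at hind ⊢
      exact add_le_add_left hind 1
    · let d' := Function.update d i (d i - 1)
      have e1 : d' i = d i - 1 := by simp [d']
      have e2 : ∀ l, l ≠ i → d' l = d l := fun l hl => by simp [d', hl]
      have e3 : d' (i + (n + 1)) = d (i + (n + 1)) := e2 _ (by omega)
      have hle : ∀ l, d' l ≤ d l := fun l => by
        by_cases hl : l = i
        · rw [hl, e1]; omega
        · rw [e2 l hl]
      have hij' : (i, i + (n + 1)) ∈ J t d' := ⟨h1, h2, h3, fun l h5 h6 => by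
        have := h4 l h5 h6
        simp only at h5 h6 ⊢
        rw [e1, e3, e2 l (by omega)]; omega⟩
      have hmin : min (d i) (d (i + (n + 1))) = d (i + (n + 1)) := by omega
      have hind := ih hij' (by omega) (by omega) (by rw [e1, e3]; omega)
      have hstep := coheight_irreducibleLocus_add_one_le (K := K) hle
        (fun l h5 h6 => e2 l (by omega)) hij hij' (by omega) (by omega)
        (by rw [e1, e3]; omega)
        (idBlock K (d (i + (n + 1))) (d i) (d i - d (i + (n + 1)))).transpose
        (by rw [hmin, Matrix.rank_transpose]; exact le_rank_idBlock (by omega))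
        (by
          rw [hmin, ← Matrix.rank_transpose]
          refine (rank_lt_of_row_eq_zero ⟨d (i + (n + 1)) - 1, by omega⟩ fun b => ?_).trans_eq e3
          have hb := b.2
          simp only [Matrix.transpose_apply, Matrix.submatrix_apply, idBlock, Fin.val_castLE]
          rw [if_neg (by omega)])
      refine le_trans ?_ hstep
      push_cast at hind ⊢
      exact add_le_add_left hind 1

/-- The bound for the codimension of the locus of matrices `F A` of rank smaller than `r`, if
`F` takes as a value the matrix with an identity block of size `r - 1`. -/
lemma coheight_le_of_exists_diagonal [IsAlgClosed K] {r m : ℕ} (hr : 0 < r) (hrm : r ≤ m)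
    {F : Rep K t d → Matrix (Fin r) (Fin m) K} (hF : RegularMatrix F)
    (W : TopologicalSpace.IrreducibleCloseds (Rep K t d))
    (hW : ∀ A, A ∈ W ↔ (F A).rank < r)
    (hA : ∃ A, F A = fun (a : Fin r) (b : Fin m) =>
      if (a : ℕ) = b ∧ (a : ℕ) < r - 1 then 1 else 0) :
    Order.coheight W ≤ (m - r + 1 : ℕ) := by
  obtain ⟨r, rfl⟩ := Nat.exists_eq_succ_of_ne_zero hr.ne'
  obtain ⟨A, hA⟩ := hA
  have h1 : A ∈ W := by
    rw [hW, hA]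
    exact rank_lt_of_row_eq_zero (Fin.last r) fun b => if_neg (by simp)
  have h2 := coheight_le_of_rank_lt hF W hW h1
    (e := Fin.castLE (by omega)) (Fin.castLE_injective (by omega)) (by
      rw [hA, ← Matrix.rank_transpose]
      convert le_rank_idBlock (K := K) (r := r) (n := r + 1) (k := 0) (by omega) using 2
      ext x a
      have hx := x.2
      simp only [Matrix.transpose_apply, idBlock]
      exact if_congr (by simp; omega) rfl rfl)
  rwa [show m - r.succ + 1 = m - r by omega]

theorem coheight_irreducibleLocus_le [IsAlgClosed K] (hij : (i, i + (n + 1)) ∈ J t d)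
    (hi : 0 < d i) (hj : 0 < d (i + (n + 1))) :
    Order.coheight (irreducibleLocus (K := K) hij hi hj) ≤
      ((((d (i + (n + 1)) : ℤ) - d i).natAbs + 1 : ℕ) : ℕ∞) := by
  rcases le_total (d i) (d (i + (n + 1))) with hle | hle
  · rw [show ((d (i + (n + 1)) : ℤ) - d i).natAbs = d (i + (n + 1)) - d i by omega]
    refine coheight_le_of_exists_diagonal hi hle (.comp i (n + 1)) _ (fun A => ?_)
      (exists_comp_eq_of_mem_J hij _)
    rw [mem_irreducibleLocus, min_eq_left hle]
  · rw [show ((d (i + (n + 1)) : ℤ) - d i).natAbs = d i - d (i + (n + 1)) by omega]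
    refine coheight_le_of_exists_diagonal (F := fun A => (A.comp i (n + 1)).transpose) hj hle
      (fun a b => RegularMatrix.comp i (n + 1) b a) _ (fun A => ?_) ?_
    · rw [mem_irreducibleLocus, min_eq_right hle, Matrix.rank_transpose]
    · obtain ⟨A, hA⟩ := exists_comp_eq_of_mem_J (K := K) hij fun a b =>
        if (b : ℕ) = a ∧ (b : ℕ) < d (i + (n + 1)) - 1 then 1 else 0
      exact ⟨A, by rw [hA]; rfl⟩

theorem codim_degeneracyLocus [IsAlgClosed K] {j : ℕ} (hij : (i, j) ∈ J t d) (hi : 0 < d i)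
    (hj : 0 < d j) :
    codim (degeneracyLocus K t d i j) = ((((d j : ℤ) - (d i : ℤ)).natAbs + 1 : ℕ) : ℕ∞) := by
  obtain ⟨n, rfl⟩ : ∃ n, j = i + (n + 1) := ⟨j - i - 1, by have := hij.2.1; simp at this; omega⟩
  exact (codim_eq_coheight (irreducibleLocus hij hi hj)).trans
    (le_antisymm (coheight_irreducibleLocus_le hij hi hj) (le_coheight_irreducibleLocus hij hi hj))

end Codimension

/-- The case `(i, j) = (1, t)`. -/
lemma almostGeneric_one {t : ℕ} {d : ℕ → ℕ} (hij : (1, t) ∈ J t d) :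
    almostGeneric t d 1 t = {(1, t - 1), (2, t)} +
      generic t (fun l => if l = 1 ∨ l = t then d l - 1 else d l - 2) := by
  have ht := hij.2.1
  simp only at ht
  have hp : brokenPair t d 1 t = {(1, t - 1), (2, t)} := by
    rw [brokenPair, leftEnd_eq le_rfl le_rfl (fun l h1 h2 => ?_) (.inl rfl),
      rightEnd_eq le_rfl le_rfl (fun l h1 h2 => ?_) (.inl rfl)]
    · rw [le_antisymm h2 h1]; exact min_le_right _ _
    · rw [le_antisymm h2 h1]; exact min_le_left _ _
  rw [almostGeneric, hp]
  congr 1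
  refine generic_congr fun l hl => ?_
  rw [Finset.mem_Icc] at hl
  have : Multisegment.dim {(1, t - 1), (2, t)} l = if l = 1 ∨ l = t then 1 else 2 := by
    rw [show ({(1, t - 1), (2, t)} : Multisegment) = (1, t - 1) ::ₘ (2, t) ::ₘ 0 from rfl,
      Multisegment.dim_cons, Multisegment.dim_cons]
    have h0 : Multisegment.dim 0 l = 0 := rfl
    rw [h0]
    split_ifs <;> simp only at * <;> omega
  rw [this]
  split_ifs <;> rfl

end QuiverA

theorem proposition3p1 (K : Type*) [Field K] [IsAlgClosed K] (t : ℕ) (d : ℕ → ℕ) (i j : ℕ)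
    (hij : (i, j) ∈ QuiverA.J t d) (hi : 0 < d i) (hj : 0 < d j) :
    IsClosed (QuiverA.degeneracyLocus K t d i j) ∧
    IsIrreducible (QuiverA.degeneracyLocus K t d i j) ∧
    QuiverA.codim (QuiverA.degeneracyLocus K t d i j) =
      ((((d j : ℤ) - (d i : ℤ)).natAbs + 1 : ℕ) : ℕ∞) ∧
    (∃ A : QuiverA.Rep K t d, A.IsoTo (QuiverA.almostGeneric t d i j) ∧
      QuiverA.degeneracyLocus K t d i j = closure A.orbit) ∧
    (i = 1 → j = t → QuiverA.almostGeneric t d i j =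
      {(1, t - 1), (2, t)} +
        QuiverA.generic t (fun l => if l = 1 ∨ l = t then d l - 1 else d l - 2)) := by
  obtain ⟨A, hA, hcl⟩ := QuiverA.exists_closure_orbit (K := K) hij hi hj
  refine ⟨QuiverA.isClosed_degeneracyLocus hij, QuiverA.isIrreducible_degeneracyLocus hij hi hj,
    QuiverA.codim_degeneracyLocus hij hi hj, ⟨A, hA.isoTo, hcl⟩, ?_⟩
  rintro rfl rfl
  exact QuiverA.almostGeneric_one hij
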